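/- Let $\mathbb{K}$ be a field, let $G$ be a finite simple graph with vertices $x_1,\dots,x_n$, and let $I(G)=(x_ix_j : \{x_i,x_j\}\in E(G))$ be its edge ideal in the standard graded polynomial ring $S=\mathbb{K}[x_1,\dots,x_n]$. For an ideal $I$ of $S$ and an integer $t\ge 1$ let $$I^{(t)}=\bigcap_{\mathfrak p\in\operatorname{Min}(I)}\operatorname{Ker}\bigl(S\to (S/I^t)_{\mathfrak p}\bigr)$$ be its $t$-th symbolic power, where $\operatorname{Min}(I)$ is the set of minimal primes of $I$. For a homogeneous ideal $I$ let $\operatorname{reg}(I)=\max\{j-i : \beta_{i,j}(I)\ne 0\}$ be its Castelnuovo--Mumford regularity, where $\beta_{i,j}(I)$ is the multiplicity of $S(-j)$ in the $i$-th module of the minimal graded free resolution of $I$ as an $S$-module (with $\operatorname{reg}(0)=-\infty$). Let $s\ge 1$ be an integer such that $G$ has no odd cycle of length at most $2s-3$. Then $$\operatorname{reg}\bigl(I(G)^{(s+1)}\bigr)\le \max\bigl\{\operatorname{reg}(I(G))+2s,\ \operatorname{reg}(I(G)^s)\bigr\}.$$ -/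

import Mathlib

open MvPolynomial

noncomputable section

/-- The edge ideal `I(G)` of a graph `G` in the polynomial ring `K[x_v : v ∈ V]`: it is generated
by the monomials `x_u x_v` with `u v` an edge of `G`. -/
def edgeIdeal (K : Type*) [Field K] {V : Type*} (G : SimpleGraph V) :
    Ideal (MvPolynomial V K) :=
  Ideal.span {f | ∃ u v : V, G.Adj u v ∧ f = X u * X v}

/-- The `s`-th symbolic power of an ideal `I` of `R`: the intersection, over the minimal primes `p`
of `I`, of the kernels of the natural maps `R → (R / I ^ s)_p`. -/
def Ideal.symbolicPower {R : Type*} [CommRing R] (I : Ideal R) (s : ℕ) : Ideal R :=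
  ⨅ p : I.minimalPrimes,
    haveI : p.1.IsPrime := Ideal.IsMinimalPrime.isPrime p.2
    LinearMap.ker
      ((LocalizedModule.mkLinearMap p.1.primeCompl (R ⧸ I ^ s)) ∘ₗ (I ^ s).mkQ)

/-- `v` is a homogeneous element of degree `j` of the graded free module `⨁ c, S(-deg c)`, where
`S = K[x_v : v ∈ V]` is standard graded: each nonzero coordinate `v c` is a form of degree
`j - deg c`. -/
def IsHomogeneousVector {K V : Type*} [Field K] {ι : Type*} (deg : ι → ℤ)
    (v : ι → MvPolynomial V K) (j : ℤ) : Prop :=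
  ∀ c : ι, ∀ m ∈ (v c).support, (m.degree : ℤ) + deg c = j

/-- A minimal graded free resolution
`⋯ → F 2 → F 1 → F 0 → I → 0` of an ideal `I` of the standard graded polynomial ring
`S = K[x_v : v ∈ V]`, with `F i = ⨁ b : Fin (rank i), S(-deg i b)` of finite rank. -/
structure MinimalGradedFreeResolution {K V : Type*} [Field K] (I : Ideal (MvPolynomial V K)) where
  /-- the rank of `F i` -/
  rank : ℕ → ℕ
  /-- the degrees of the basis elements of `F i` -/
  deg : ∀ i, Fin (rank i) → ℤ
  /-- the augmentation `F 0 → I ⊆ S` -/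
  aug : (Fin (rank 0) → MvPolynomial V K) →ₗ[MvPolynomial V K] MvPolynomial V K
  /-- the differential `F (i + 1) → F i` -/
  d : ∀ i, (Fin (rank (i + 1)) → MvPolynomial V K) →ₗ[MvPolynomial V K]
    (Fin (rank i) → MvPolynomial V K)
  /-- the augmentation preserves degrees -/
  aug_homogeneous : ∀ b, ∀ m ∈ (aug (Pi.single b 1)).support, (m.degree : ℤ) = deg 0 b
  /-- the differentials preserve degrees -/
  d_homogeneous : ∀ i b, IsHomogeneousVector (deg i) (d i (Pi.single b 1)) (deg (i + 1) b)
  /-- the augmentation maps onto `I` -/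
  range_aug : LinearMap.range aug = I
  /-- exactness at `F 0` -/
  exact_zero : LinearMap.ker aug = LinearMap.range (d 0)
  /-- exactness at `F (i + 1)` -/
  exact_succ : ∀ i, LinearMap.ker (d i) = LinearMap.range (d (i + 1))
  /-- minimality: the entries of the matrices of the differentials lie in the ideal generated by
  the variables -/
  minimal : ∀ i b c, constantCoeff (d i (Pi.single b 1) c) = 0

open Classical in
/-- The graded Betti number `β_{i,j}(I)`: the multiplicity of `S(-j)` in the `i`-th module of a
minimal graded free resolution of `I` (which is unique up to isomorphism, and exists whenever `V` is
finite and `I` is homogeneous). -/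
def gradedBetti {K V : Type*} [Field K] (I : Ideal (MvPolynomial V K)) (i : ℕ) (j : ℤ) : ℕ :=
  if h : Nonempty (MinimalGradedFreeResolution I) then
    Nat.card {b : Fin (h.some.rank i) // h.some.deg i b = j}
  else 0

/-- The Castelnuovo-Mumford regularity `reg(I) = max {j - i | β_{i,j}(I) ≠ 0}` of an ideal,
regarded as a graded module; the regularity of the zero ideal is `⊥`, that is, `-∞`. -/
def regularity {K V : Type*} [Field K] (I : Ideal (MvPolynomial V K)) : WithBot (WithTop ℤ) :=
  sSup {r | ∃ (i : ℕ) (j : ℤ), gradedBetti I i j ≠ 0 ∧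
    r = (((j - i : ℤ) : WithTop ℤ) : WithBot (WithTop ℤ))}

end

/-! Write `I` for the edge ideal and `J` for its symbolic power of exponent `s + 1`. A monomial
`x^a` lies in `J` exactly when `a` has weight at least `s + 1` on every vertex cover, and in `I^s`
exactly when it is divisible by a product of `s` edges. The graded Betti numbers of a monomial ideal
are governed by the reduced homology of its upper Koszul complexes (`gradedBetti_ne_zero_iff`). A
regularity bound thus becomes a range of vanishing homology (`RegLE`), and the exact sequences
relating ideals become Mayer–Vietoris arguments.

The hypothesis on odd cycles enters once, to give `J ⊆ I^s`
(`symbolicMonomials_subset_powerMonomials`): replacing each vertex `x` by `a x` copies turns the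
claim into the existence of a matching with `s` edges in a graph with cover number above `s` and no
short odd closed walks.

One then descends from `I^s` to `J` by discarding the products of `s` edges one at a time, the
lexicographically smallest first. If `L` is generated by `J` and the products larger than `m`, then
`reg L ≤ max (reg (L : m) + 2s, reg (L + (m)))`, so it suffices to bound `reg (L : m)` by `reg I`.
Two facts give this.

First, `L : m` is `J : m` plus variables (`setOf_add_mem_symbolicMonomials_union`). If the lcm of
two edge products is not in `J`, a cover meets both of them minimally; they then agree on the cover,
and off it they satisfy a polymatroidal exchange property. Adding variables does not raise a
regularity bound that is at least 1 (`RegLEOff.union_variables`).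

Second, `reg (J : m) ≤ reg I` (`regLE_transversalMonomials`). The colon ideal is reached from `I` by
treating the edges `uv` of `m` one by one, replacing the current ideal `T` by `(T : u) ∩ (T : v)`.
Each `T` is generated by variables and squarefree quadrics, or is the unit ideal. The colons by `u`
and `v` do not raise regularity, and in the essential case their sum `T + (N(u) ∪ N(v))` has
regularity at most `reg T - 1`, so Mayer–Vietoris bounds the intersection. -/

set_option linter.unusedSectionVars false

noncomputable section

/-! ## The Koszul boundary -/

section Boundary

variable {V : Type*} [LinearOrder V]

/-- The sign with which a vertex `x` occurs in the boundary at the face `τ`. -/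
def koszulSign (x : V) (τ : Finset V) : ℤ := (-1) ^ (τ.filter (· < x)).card

lemma koszulSign_mul_self (x : V) (τ : Finset V) : koszulSign x τ * koszulSign x τ = 1 := by
  unfold koszulSign
  rw [← mul_pow]; simp

lemma koszulSign_insert {x y : V} {τ : Finset V} (hx : x ∉ τ) :
    koszulSign y (insert x τ) = koszulSign y τ * (if x < y then -1 else 1) := by
  unfold koszulSign
  rw [Finset.filter_insert]
  split_ifs with h
  · rw [Finset.card_insert_of_notMem (by simp [hx]), pow_succ]
  · simp

lemma koszulSign_swap {x y : V} {τ : Finset V} (hx : x ∉ τ) (hy : y ∉ τ) (hxy : x ≠ y) :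
    koszulSign x τ * koszulSign y (insert x τ) = -(koszulSign y τ * koszulSign x (insert y τ)) := by
  rw [koszulSign_insert hx, koszulSign_insert hy]
  rcases lt_or_gt_of_ne hxy with h | h
  · rw [if_pos h, if_neg h.not_gt]; ring
  · rw [if_pos h, if_neg h.not_gt]; ring

lemma koszulSign_insert_self {x : V} {τ : Finset V} (hx : x ∉ τ) :
    koszulSign x (insert x τ) = koszulSign x τ := by
  rw [koszulSign_insert hx, if_neg (lt_irrefl x), mul_one]

variable [Fintype V] {R N : Type*} [CommRing R] [AddCommGroup N] [Module R N]

/-- The Koszul differential on `N ⊗ ⋀ R^V` with respect to the sequence `w`; a chain is given by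
its coefficients at the finite subsets of `V`. -/
def koszulD (w : V → R) : (Finset V → N) →ₗ[R] (Finset V → N) where
  toFun c τ := ∑ x ∈ τᶜ, koszulSign x τ • w x • c (insert x τ)
  map_add' c c' := by
    ext τ
    simp [Finset.sum_add_distrib, smul_add]
  map_smul' r c := by
    ext τ
    simp only [Pi.smul_apply, RingHom.id_apply, Finset.smul_sum]
    refine Finset.sum_congr rfl fun x _ => ?_
    rw [smul_comm (w x) r, smul_comm (koszulSign x τ) r]

lemma koszulD_apply (w : V → R) (c : Finset V → N) (τ : Finset V) :
    koszulD w c τ = ∑ x ∈ τᶜ, koszulSign x τ • w x • c (insert x τ) := rfl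

/-- Adjoining `x` then `y` cancels against adjoining `y` then `x`, by `koszulSign_swap`. -/
lemma koszulD_koszulD (w : V → R) (c : Finset V → N) : koszulD w (koszulD w c) = 0 := by
  ext τ
  simp only [koszulD_apply, Pi.zero_apply, Finset.smul_sum]
  rw [Finset.sum_sigma']
  refine Finset.sum_involution (fun p _ => ⟨p.2, p.1⟩) ?_ ?_ ?_ ?_
  · rintro ⟨x, y⟩ h
    simp only [Finset.mem_sigma, Finset.mem_compl, Finset.mem_insert, not_or] at h
    obtain ⟨hx, hyx, hy⟩ := h
    have h1 := koszulSign_swap hx hy (Ne.symm hyx)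
    rw [Finset.insert_comm y x τ]
    simp only [smul_comm (w _) (koszulSign _ _), smul_smul, h1]
    rw [mul_comm (w y) (w x), neg_smul, neg_add_cancel]
  · rintro ⟨x, y⟩ h _ h'
    simp only [Finset.mem_sigma, Finset.mem_compl, Finset.mem_insert, not_or] at h
    exact h.2.1 (by simpa using congrArg Sigma.fst h')
  · rintro ⟨x, y⟩ h
    simp only [Finset.mem_sigma, Finset.mem_compl, Finset.mem_insert, not_or] at h ⊢
    exact ⟨h.2.2, Ne.symm h.2.1, h.1⟩
  · rintro ⟨x, y⟩ h
    rfl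

/-- Exterior multiplication by the basis vector of `v`. -/
def koszulH (v : V) (c : Finset V → N) : Finset V → N :=
  fun τ => if v ∈ τ then koszulSign v τ • c (τ.erase v) else 0

/-- The homotopy formula `dh + hd = w v`. With `w = 1` it contracts every cone with apex `v`. -/
lemma koszulD_koszulH (w : V → R) (v : V) (c : Finset V → N) :
    koszulD w (koszulH v c) + koszulH v (koszulD w c) = w v • c := by
  ext τ
  simp only [Pi.add_apply, Pi.smul_apply, koszulD_apply, koszulH]
  by_cases hv : v ∈ τ
  · obtain ⟨σ, hσ, rfl⟩ : ∃ σ, v ∉ σ ∧ τ = insert v σ :=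
      ⟨τ.erase v, by simp, (Finset.insert_erase hv).symm⟩
    have e1 : (σ : Finset V)ᶜ = insert v (insert v σ)ᶜ := by
      ext y; by_cases h : y = v <;> simp [h, hσ]
    rw [if_pos hv, Finset.erase_insert hσ, e1, Finset.sum_insert (by simp), smul_add,
      koszulSign_insert_self hσ, smul_smul, koszulSign_mul_self, one_smul, add_left_comm,
      Finset.smul_sum, ← Finset.sum_add_distrib, Finset.sum_eq_zero, add_zero]
    intro x hx
    simp only [Finset.mem_compl, Finset.mem_insert, not_or] at hx
    have hx' : v ≠ x := Ne.symm hx.1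
    rw [if_pos (by simp), Finset.insert_comm, Finset.erase_insert (by simp [hσ, hx']),
      smul_comm (w x), smul_smul, smul_smul, ← add_smul]
    have := koszulSign_swap hσ hx.2 hx'
    rw [koszulSign_insert (y := v) (show v ∉ insert x σ by simp [hσ, hx']), if_neg (lt_irrefl v),
      mul_one]
    have h2 : koszulSign x (insert v σ) * koszulSign v (insert x σ) +
        koszulSign v σ * koszulSign x σ = 0 := by
      have a1 := koszulSign_insert (y := x) hσ
      have a2 := koszulSign_insert (y := v) hx.2
      rw [a1, a2]
      rcases lt_or_gt_of_ne hx' with h | h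
      · rw [if_pos h, if_neg h.not_gt]; ring
      · rw [if_pos h, if_neg h.not_gt]; ring
    rw [h2, zero_smul]
  · rw [if_neg hv, add_zero, Finset.sum_eq_single v]
    · rw [if_pos (by simp), Finset.erase_insert hv, koszulSign_insert_self hv,
        smul_comm (w v), smul_smul, koszulSign_mul_self, one_smul]
    · intro x hx hxv
      rw [if_neg (by simp [hv, Ne.symm hxv]), smul_zero, smul_zero]
    · intro h; simp [hv] at h

end Boundary

/-! ## Acyclicity of simplicial complexes -/

section Acyclic

variable {V : Type*} [LinearOrder V] [Fintype V] {K : Type*} [Field K]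

/-- The simplicial boundary map. -/
abbrev simplicialD : (Finset V → K) →ₗ[K] (Finset V → K) := koszulD (fun _ => (1 : K))

/-- `c` is a simplicial chain of `Δ` on faces with `p` vertices. -/
def IsSimplicialChain (Δ : Set (Finset V)) (p : ℕ) (c : Finset V → K) : Prop :=
  ∀ τ, c τ ≠ 0 → τ ∈ Δ ∧ τ.card = p

variable (K) in
/-- The reduced homology of `Δ` with coefficients in `K` vanishes in dimension `p - 1`. -/
def AcyclicAt (Δ : Set (Finset V)) (p : ℕ) : Prop :=
  ∀ c : Finset V → K, IsSimplicialChain Δ p c → simplicialD c = 0 →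
    ∃ c' : Finset V → K, IsSimplicialChain Δ (p + 1) c' ∧ simplicialD c' = c

variable {A B Δ : Set (Finset V)} {p : ℕ} {c c' : Finset V → K}

lemma IsSimplicialChain.add (h : IsSimplicialChain Δ p c) (h' : IsSimplicialChain Δ p c') :
    IsSimplicialChain Δ p (c + c') := by
  intro τ hτ
  by_cases h0 : c τ = 0
  · exact h' τ (by simpa [h0] using hτ)
  · exact h τ h0

lemma IsSimplicialChain.neg (h : IsSimplicialChain Δ p c) : IsSimplicialChain Δ p (-c) := by
  intro τ hτ
  exact h τ (by simpa using hτ)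

lemma IsSimplicialChain.sub (h : IsSimplicialChain Δ p c) (h' : IsSimplicialChain Δ p c') :
    IsSimplicialChain Δ p (c - c') := by
  rw [sub_eq_add_neg]; exact h.add h'.neg

lemma IsSimplicialChain.mono (h : IsSimplicialChain A p c) (hAB : A ⊆ B) :
    IsSimplicialChain B p c := fun τ hτ => ⟨hAB (h τ hτ).1, (h τ hτ).2⟩

lemma IsSimplicialChain.inter (h : IsSimplicialChain A p c) (h' : IsSimplicialChain B p c) :
    IsSimplicialChain (A ∩ B) p c := fun τ hτ => ⟨⟨(h τ hτ).1, (h' τ hτ).1⟩, (h τ hτ).2⟩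

lemma IsSimplicialChain.exists_add (h : IsSimplicialChain (A ∪ B) p c) :
    ∃ a b : Finset V → K, IsSimplicialChain A p a ∧ IsSimplicialChain B p b ∧ c = a + b := by
  classical
  refine ⟨fun τ => if τ ∈ A then c τ else 0, fun τ => if τ ∈ A then 0 else c τ, ?_, ?_, ?_⟩
  · intro τ hτ
    by_cases hA : τ ∈ A
    · exact ⟨hA, (h τ (by simpa [hA] using hτ)).2⟩
    · simp [hA] at hτ
  · intro τ hτ
    by_cases hA : τ ∈ A
    · simp [hA] at hτ
    · have := h τ (by simpa [hA] using hτ)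
      exact ⟨this.1.resolve_left hA, this.2⟩
  · ext τ
    by_cases hA : τ ∈ A <;> simp [hA]

lemma IsSimplicialChain.simplicialD (hΔ : IsLowerSet Δ) (h : IsSimplicialChain Δ (p + 1) c) :
    IsSimplicialChain Δ p (simplicialD c) := by
  intro τ hτ
  rw [koszulD_apply] at hτ
  obtain ⟨x, hx, hne⟩ := Finset.exists_ne_zero_of_sum_ne_zero hτ
  have hc : c (insert x τ) ≠ 0 := by
    intro h0; simp [h0] at hne
  obtain ⟨h1, h2⟩ := h _ hc
  rw [Finset.card_insert_of_notMem (by simpa using hx)] at h2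
  exact ⟨hΔ (Finset.subset_insert x τ) h1, by omega⟩

lemma IsSimplicialChain.simplicialD_zero (h : IsSimplicialChain Δ 0 c) :
    _root_.simplicialD c = 0 := by
  ext τ
  rw [koszulD_apply]
  refine Finset.sum_eq_zero fun x _ => ?_
  have : c (insert x τ) = 0 := by
    by_contra h0
    have := (h _ h0).2
    simp at this
  simp [this]

lemma acyclicAt_of_forall_notMem (h : ∀ τ, τ ∉ Δ) : AcyclicAt K Δ p := by
  intro c hc _
  refine ⟨0, fun τ hτ => (hτ rfl).elim, ?_⟩
  rw [map_zero]
  ext τ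
  by_contra h0
  exact h τ (hc τ (Ne.symm h0)).1

/-- Cones are acyclic. -/
lemma acyclicAt_of_cone (v : V) (h : ∀ τ ∈ Δ, insert v τ ∈ Δ) : AcyclicAt K Δ p := by
  intro c hc hd
  refine ⟨koszulH v c, ?_, ?_⟩
  · intro τ hτ
    unfold koszulH at hτ
    split_ifs at hτ with hv
    · have h0 : c (τ.erase v) ≠ 0 := by
        intro h0; simp [h0] at hτ
      obtain ⟨h1, h2⟩ := hc _ h0
      have h3 := h _ h1
      rw [Finset.insert_erase hv] at h3
      refine ⟨h3, ?_⟩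
      rw [← h2, Finset.card_erase_add_one hv]
    · exact (hτ rfl).elim
  · have := koszulD_koszulH (fun _ : V => (1 : K)) v c
    have h0 : koszulH v (0 : Finset V → K) = 0 := by
      ext τ; simp [koszulH]
    simp only [simplicialD] at hd ⊢
    rw [hd, h0, add_zero, one_smul] at this
    exact this

/-- Exactness of Mayer–Vietoris at `H(A) ⊕ H(B)`, applied to classes supported on `A`; no acyclicity
of `B` is needed. -/
lemma acyclicAt_left_of_inter_of_union (hA : IsLowerSet A) (hB : IsLowerSet B)
    (h1 : AcyclicAt K (A ∩ B) p) (h2 : AcyclicAt K (A ∪ B) p) : AcyclicAt K A p := by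
  intro c hc hd
  obtain ⟨μ, hμ, rfl⟩ := h2 c (hc.mono Set.subset_union_left) hd
  obtain ⟨a, b, ha, hb, rfl⟩ := hμ.exists_add
  have e : simplicialD b = simplicialD (a + b) - simplicialD a := by rw [map_add]; abel
  have hb' : IsSimplicialChain (A ∩ B) p (simplicialD b) := by
    refine IsSimplicialChain.inter ?_ (hb.simplicialD hB)
    rw [e]
    exact hc.sub (ha.simplicialD hA)
  obtain ⟨ν, hν, hν'⟩ := h1 _ hb' (koszulD_koszulD _ _)
  exact ⟨a + ν, ha.add (hν.mono Set.inter_subset_left), by rw [map_add, map_add, hν']⟩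

/-- Mayer–Vietoris at `H(A ∩ B)`: two fillings `α` and `β` differ by a cycle of the union one
dimension higher, and splitting a filling of that cycle moves `α` into the intersection. -/
lemma acyclicAt_inter (hA : IsLowerSet A) (hB : IsLowerSet B)
    (h1 : AcyclicAt K A p) (h2 : AcyclicAt K B p) (h3 : AcyclicAt K (A ∪ B) (p + 1)) :
    AcyclicAt K (A ∩ B) p := by
  intro c hc hd
  obtain ⟨α, hα, hα'⟩ := h1 c (hc.mono Set.inter_subset_left) hd
  obtain ⟨β, hβ, hβ'⟩ := h2 c (hc.mono Set.inter_subset_right) hd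
  obtain ⟨γ, hγ, hγ'⟩ := h3 (α - β)
    ((hα.mono Set.subset_union_left).sub (hβ.mono Set.subset_union_right))
    (by rw [map_sub, hα', hβ', sub_self])
  obtain ⟨a, b, ha, hb, rfl⟩ := hγ.exists_add
  refine ⟨α - simplicialD a, IsSimplicialChain.inter (hα.sub (ha.simplicialD hA)) ?_, ?_⟩
  · have : α - simplicialD a = β + simplicialD b := by
      rw [map_add] at hγ'
      rw [sub_eq_iff_eq_add, add_assoc, add_comm (simplicialD b), hγ']; abel
    rw [this]
    exact hβ.add (hb.simplicialD hB)
  · rw [map_sub, hα', koszulD_koszulD, sub_zero]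

/-- Chains on the empty face are automatically cycles, so the two summands can be filled separately,
with no condition on `A ∩ B`. -/
lemma acyclicAt_union_zero (h1 : AcyclicAt K A 0) (h2 : AcyclicAt K B 0) :
    AcyclicAt K (A ∪ B) 0 := by
  intro c hc _
  obtain ⟨a, b, ha, hb, rfl⟩ := hc.exists_add
  obtain ⟨α, hα, rfl⟩ := h1 a ha ha.simplicialD_zero
  obtain ⟨β, hβ, rfl⟩ := h2 b hb hb.simplicialD_zero
  exact ⟨α + β, (hα.mono Set.subset_union_left).add (hβ.mono Set.subset_union_right), map_add _ _ _⟩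

/-- Mayer–Vietoris at `H(A ∪ B)`: the common boundary of the two pieces is filled in `A ∩ B`, which
makes each piece a cycle after correction. -/
lemma acyclicAt_union_succ (hA : IsLowerSet A) (hB : IsLowerSet B)
    (h1 : AcyclicAt K A (p + 1)) (h2 : AcyclicAt K B (p + 1)) (h3 : AcyclicAt K (A ∩ B) p) :
    AcyclicAt K (A ∪ B) (p + 1) := by
  intro c hc hd
  obtain ⟨a, b, ha, hb, rfl⟩ := hc.exists_add
  have e : simplicialD a = - simplicialD b := by
    rw [map_add] at hd
    exact eq_neg_of_add_eq_zero_left hd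
  obtain ⟨ν, hν, hν'⟩ := h3 (simplicialD a)
    (IsSimplicialChain.inter (ha.simplicialD hA) (by rw [e]; exact (hb.simplicialD hB).neg))
    (koszulD_koszulD _ _)
  obtain ⟨α, hα, hα'⟩ := h1 (a - ν) (ha.sub (hν.mono Set.inter_subset_left))
    (by rw [map_sub, hν', sub_self])
  obtain ⟨β, hβ, hβ'⟩ := h2 (b + ν) (hb.add (hν.mono Set.inter_subset_right))
    (by rw [map_add, hν', e, add_neg_cancel])
  exact ⟨α + β, (hα.mono Set.subset_union_left).add (hβ.mono Set.subset_union_right),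
    by rw [map_add, hα', hβ']; abel⟩

end Acyclic

/-! ## Upper Koszul complexes of sets of monomials -/

section Koszul

variable {V : Type*} [LinearOrder V] [Fintype V] {K : Type*} [Field K]

/-- The exponent of the squarefree monomial with support `τ`. -/
def indVec (τ : Finset V) : V →₀ ℕ := Finsupp.indicator τ fun _ _ => 1

lemma indVec_apply (τ : Finset V) (x : V) : indVec τ x = if x ∈ τ then 1 else 0 := by
  simp [indVec, Finsupp.indicator_apply]

lemma single_one_apply (x y : V) : (Finsupp.single x 1 : V →₀ ℕ) y = if x = y then 1 else 0 :=
  Finsupp.single_apply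

lemma degree_single_one (x : V) : (Finsupp.single x 1 : V →₀ ℕ).degree = 1 := by
  simp [Finsupp.degree_single]

/-- The upper Koszul complex of a set `U` of monomials in the multidegree `a`. -/
def koszulComplex (U : Set (V →₀ ℕ)) (a : V →₀ ℕ) : Set (Finset V) :=
  {τ | ∃ b ∈ U, b + indVec τ = a}

variable {U U' : Set (V →₀ ℕ)} {a : V →₀ ℕ} {τ : Finset V}

lemma mem_koszulComplex_iff : τ ∈ koszulComplex U a ↔ indVec τ ≤ a ∧ a - indVec τ ∈ U := by
  constructor
  · rintro ⟨b, hb, rfl⟩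
    exact ⟨le_add_self, by simpa using hb⟩
  · rintro ⟨h1, h2⟩
    exact ⟨_, h2, tsub_add_cancel_of_le h1⟩

lemma isLowerSet_koszulComplex (hU : IsUpperSet U) : IsLowerSet (koszulComplex U a) := by
  rintro τ σ hσ ⟨b, hb, rfl⟩
  refine ⟨b + indVec (τ \ σ), hU le_self_add hb, ?_⟩
  ext x
  simp only [Finsupp.add_apply, indVec_apply, Finset.mem_sdiff]
  by_cases h1 : x ∈ σ
  · have := hσ h1
    simp [h1, this]
  · simp [h1]

lemma koszulComplex_union :
    koszulComplex (U ∪ U') a = koszulComplex U a ∪ koszulComplex U' a := by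
  ext τ
  simp only [mem_koszulComplex_iff, Set.mem_union]
  tauto

lemma koszulComplex_inter :
    koszulComplex (U ∩ U') a = koszulComplex U a ∩ koszulComplex U' a := by
  ext τ
  simp only [mem_koszulComplex_iff, Set.mem_inter_iff]
  tauto

variable (K) in
/-- The Koszul homology of the set `U` of monomials vanishes in homological degree `p` and
all multidegrees `a` with `|a| - p > r` that do not involve the variables in `W`. -/
def RegLEOff (W : Set V) (U : Set (V →₀ ℕ)) (r : ℤ) : Prop :=
  ∀ a : V →₀ ℕ, (∀ w ∈ W, a w = 0) → ∀ p : ℕ, r < (a.degree : ℤ) - p →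
    AcyclicAt K (koszulComplex U a) p

variable (K) in
/-- The set `U` of monomials spans a module of regularity at most `r`. -/
abbrev RegLE (U : Set (V →₀ ℕ)) (r : ℤ) : Prop := RegLEOff K ∅ U r

lemma RegLE.off {r : ℤ} (W : Set V) (h : RegLE K U r) : RegLEOff K W U r :=
  fun a _ p hp => h a (by simp) p hp

lemma isUpperSet_colon (hU : IsUpperSet U) (m : V →₀ ℕ) : IsUpperSet {b | b + m ∈ U} :=
  fun _ _ h hb => hU (add_le_add_left h m) hb

/-- The intersection of `U` with the ideal `(m)` is the colon ideal shifted by `m`; Mayer–Vietoris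
for `U` and `(m)` then bounds `U`. -/
lemma regLE_of_colon_of_union {r : ℤ} (hU : IsUpperSet U) (m : V →₀ ℕ)
    (h1 : RegLE K {b | b + m ∈ U} r) (h2 : RegLE K (U ∪ Set.Ici m) (r + m.degree)) :
    RegLE K U (r + m.degree) := by
  intro a ha p hp
  refine acyclicAt_left_of_inter_of_union (isLowerSet_koszulComplex hU)
    (isLowerSet_koszulComplex (U := Set.Ici m) (isUpperSet_Ici m)) ?_
    (by rw [← koszulComplex_union]; exact h2 a ha p hp)
  rw [← koszulComplex_inter]
  by_cases hm : m ≤ a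
  · obtain ⟨a', rfl⟩ := exists_add_of_le hm
    have e : koszulComplex (U ∩ Set.Ici m) (m + a') = koszulComplex {b | b + m ∈ U} a' := by
      ext τ
      constructor
      · rintro ⟨b, ⟨hb, hmb⟩, h⟩
        obtain ⟨b', rfl⟩ := exists_add_of_le (Set.mem_Ici.1 hmb)
        refine ⟨b', by rwa [Set.mem_ofPred_eq, add_comm], ?_⟩
        rw [add_assoc] at h
        exact add_left_cancel h
      · rintro ⟨b, hb, rfl⟩
        exact ⟨b + m, ⟨hb, Set.mem_Ici.2 le_add_self⟩, by abel⟩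
    rw [e]
    refine h1 a' (by simp) p ?_
    rw [map_add] at hp
    push_cast at hp
    omega
  · refine acyclicAt_of_forall_notMem ?_
    rintro τ ⟨b, ⟨_, hb⟩, rfl⟩
    exact hm (le_trans hb le_self_add)

/-- If `a x ≠ 0`, the complex of the colon at `a` is that of `U` at `a + e_x`. If `a x = 0`, the
latter complex is the union of the deletion `D` of `x` and the star `St` of `x`; here `D` is the
complex of the colon, and `D ∩ St`, the link, is the complex of `U` at `a`. -/
lemma RegLE.colon_variable {r : ℤ} (hU : IsUpperSet U) (h : RegLE K U r) (x : V) :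
    RegLE K {b | b + Finsupp.single x 1 ∈ U} r := by
  intro a _ p hp
  have hd : (a + Finsupp.single x 1).degree = a.degree + 1 := by
    rw [map_add, degree_single_one]
  have hbig : AcyclicAt K (koszulComplex U (a + Finsupp.single x 1)) p :=
    h _ (by simp) p (by rw [hd]; push_cast; omega)
  by_cases hx : a x = 0
  · have hK := isLowerSet_koszulComplex (a := a + Finsupp.single x 1) hU
    set D : Set (Finset V) := {τ | x ∉ τ ∧ τ ∈ koszulComplex U (a + Finsupp.single x 1)} with hD
    set St : Set (Finset V) := {τ | insert x τ ∈ koszulComplex U (a + Finsupp.single x 1)} with hSt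
    have e1 : koszulComplex {b | b + Finsupp.single x 1 ∈ U} a = D := by
      ext τ
      constructor
      · rintro ⟨b, hb, rfl⟩
        refine ⟨?_, _, hb, by abel⟩
        intro hxτ
        simp [indVec_apply, hxτ] at hx
      · rintro ⟨hxτ, b, hb, h⟩
        have hbx : 1 ≤ b x := by
          have := DFunLike.congr_fun h x
          simp [indVec_apply, hxτ] at this
          omega
        have hs : Finsupp.single x 1 ≤ b := by simpa using hbx
        refine ⟨b - Finsupp.single x 1, ?_, ?_⟩
        · rwa [Set.mem_ofPred_eq, tsub_add_cancel_of_le hs]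
        · rw [← tsub_add_cancel_of_le hs, add_right_comm] at h
          exact add_right_cancel h
    have e2 : D ∪ St = koszulComplex U (a + Finsupp.single x 1) := by
      ext τ
      constructor
      · rintro (h | h)
        · exact h.2
        · exact hK (Finset.subset_insert x τ) h
      · intro h
        by_cases hxτ : x ∈ τ
        · right
          rwa [hSt, Set.mem_ofPred_eq, Finset.insert_eq_self.2 hxτ]
        · exact Or.inl ⟨hxτ, h⟩
    have e3 : D ∩ St = koszulComplex U a := by
      ext τ
      constructor
      · rintro ⟨⟨hxτ, _⟩, b, hb, h⟩
        refine ⟨b, hb, ?_⟩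
        ext y
        have := DFunLike.congr_fun h y
        simp only [Finsupp.add_apply, indVec_apply, single_one_apply, Finset.mem_insert] at this ⊢
        by_cases hy : y = x
        · subst hy; simp [hxτ] at this ⊢; omega
        · simpa [hy, Ne.symm hy] using this
      · rintro ⟨b, hb, rfl⟩
        have hxτ : x ∉ τ := by
          intro hxτ
          simp [indVec_apply, hxτ] at hx
        have h2 : insert x τ ∈ koszulComplex U (b + indVec τ + Finsupp.single x 1) := by
          refine ⟨b, hb, ?_⟩
          ext y
          simp only [Finsupp.add_apply, indVec_apply, single_one_apply, Finset.mem_insert]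
          by_cases hy : y = x
          · subst hy; simp [hxτ]
          · simp [hy, Ne.symm hy]
        exact ⟨⟨hxτ, hK (Finset.subset_insert x τ) h2⟩, h2⟩
    rw [e1]
    refine acyclicAt_left_of_inter_of_union (B := St) ?_ ?_ ?_ ?_
    · rw [← e1]; exact isLowerSet_koszulComplex (isUpperSet_colon hU _)
    · intro σ τ hστ h
      exact hK (Finset.insert_subset_insert x hστ) h
    · rw [e3]; exact h a (by simp) p hp
    · rw [e2]; exact hbig
  · have e : koszulComplex {b | b + Finsupp.single x 1 ∈ U} a =
        koszulComplex U (a + Finsupp.single x 1) := by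
      ext τ
      constructor
      · rintro ⟨b, hb, rfl⟩
        exact ⟨_, hb, by abel⟩
      · rintro ⟨b, hb, h⟩
        have hbx : 1 ≤ b x := by
          have := DFunLike.congr_fun h x
          simp only [Finsupp.add_apply, indVec_apply, single_one_apply] at this
          split_ifs at this <;> omega
        have hs : Finsupp.single x 1 ≤ b := by simpa using hbx
        refine ⟨b - Finsupp.single x 1, ?_, ?_⟩
        · rwa [Set.mem_ofPred_eq, tsub_add_cancel_of_le hs]
        · rw [← tsub_add_cancel_of_le hs, add_right_comm] at h
          exact add_right_cancel h
    rw [e]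
    exact hbig

lemma isUpperSet_variables (W : Set V) : IsUpperSet {b : V →₀ ℕ | ∃ w ∈ W, b w ≠ 0} := by
  rintro b b' h ⟨w, hw, hb⟩
  exact ⟨w, hw, fun h0 => hb (by have := h w; omega)⟩

/-- Modulo `x_w` only multidegrees with `a w ≤ 1` matter. For `a w = 0` the new variable is
invisible; for `a = e_w + a'` the complex is the union of a full simplex and a cone, meeting in the
complex of `U` at `a'`, so homology drops by one dimension together with the degree. Hence `U` has
to be controlled only where `w` is absent. -/
lemma RegLEOff.union_variable {r : ℤ} {W : Set V} {w : V} (hr : 1 ≤ r) (hU : IsUpperSet U)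
    (h : RegLEOff K (insert w W) U r) : RegLEOff K W (U ∪ {b | b w ≠ 0}) r := by
  intro a ha p hp
  have hw' : IsUpperSet {b : V →₀ ℕ | b w ≠ 0} := by
    intro b b' h hb h0
    exact hb (by have := h w; omega)
  have hUw : IsUpperSet (U ∪ {b : V →₀ ℕ | b w ≠ 0}) := hU.union hw'
  rcases Nat.lt_or_ge 1 (a w) with h2 | h1
  · refine acyclicAt_of_cone w ?_
    intro τ hτ
    by_cases hwτ : w ∈ τ
    · rwa [Finset.insert_eq_self.2 hwτ]
    · rw [mem_koszulComplex_iff] at hτ ⊢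
      refine ⟨fun y => ?_, Or.inr ?_⟩
      · have := hτ.1 y
        rw [indVec_apply] at this ⊢
        by_cases hy : y = w
        · subst hy; simp; omega
        · simpa [hy] using this
      · simp [indVec_apply]; omega
  rcases Nat.lt_or_ge (a w) 1 with h0 | h1'
  · have e : koszulComplex (U ∪ {b | b w ≠ 0}) a = koszulComplex U a := by
      rw [koszulComplex_union, Set.union_eq_left]
      rintro τ ⟨b, hb, rfl⟩
      rw [Finsupp.add_apply] at h0
      exact absurd (show b w = 0 by omega) hb
    rw [e]
    refine h a ?_ p hp
    rintro w' (rfl | hw')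
    · omega
    · exact ha w' hw'
  have haw : a w = 1 := le_antisymm h1 h1'
  have hs : Finsupp.single w 1 ≤ a := by simpa using h1'
  obtain ⟨a', rfl⟩ := exists_add_of_le hs
  have ha'w : a' w = 0 := by simpa using haw
  have hdeg : (Finsupp.single w 1 + a').degree = a'.degree + 1 := by
    rw [map_add, degree_single_one, add_comm]
  have hlow := isLowerSet_koszulComplex (a := Finsupp.single w 1 + a') hUw
  have hlow' := isLowerSet_koszulComplex (a := Finsupp.single w 1 + a') hU
  set A : Set (Finset V) := {τ | indVec τ ≤ a'} with hA
  set B : Set (Finset V) := {τ | insert w τ ∈ koszulComplex U (Finsupp.single w 1 + a')} with hB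
  have hind : ∀ τ, w ∉ τ → indVec τ + Finsupp.single w 1 = indVec (insert w τ) := by
    intro τ hτ
    ext y
    simp only [Finsupp.add_apply, indVec_apply, single_one_apply, Finset.mem_insert]
    by_cases hy : y = w
    · subst hy; simp [hτ]
    · simp [hy, Ne.symm hy]
  have hAnot : ∀ τ ∈ A, w ∉ τ := by
    intro τ hτ hwτ
    have := hτ w
    simp [indVec_apply, hwτ, ha'w] at this
  have e1 : koszulComplex (U ∪ {b | b w ≠ 0}) (Finsupp.single w 1 + a') = A ∪ B := by
    ext τ
    constructor
    · intro hτ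
      by_cases hwτ : w ∈ τ
      · right
        rw [hB, Set.mem_ofPred_eq, Finset.insert_eq_self.2 hwτ]
        obtain ⟨b, hb | hb, h⟩ := hτ
        · exact ⟨b, hb, h⟩
        · have := DFunLike.congr_fun h w
          simp only [Finsupp.add_apply, indVec_apply, single_one_apply, hwτ, if_true, ha'w] at this
          exact absurd (by omega) hb
      · left
        have := (mem_koszulComplex_iff.1 hτ).1
        intro y
        have hy' := this y
        by_cases hy : y = w
        · subst hy; simp [indVec_apply, hwτ]
        · simpa [single_one_apply, Ne.symm hy] using hy'
    · rintro (hτ | hτ)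
      · refine mem_koszulComplex_iff.2 ⟨le_trans hτ le_add_self, Or.inr ?_⟩
        have := hAnot τ hτ
        simp [indVec_apply, this]
      · refine hlow (Finset.subset_insert w τ) ?_
        rw [koszulComplex_union]
        exact Or.inl hτ
  have e2 : A ∩ B = koszulComplex U a' := by
    ext τ
    constructor
    · rintro ⟨hτ, b, hb, h⟩
      refine ⟨b, hb, ?_⟩
      rw [← hind τ (hAnot τ hτ), ← add_assoc, add_comm (Finsupp.single w 1)] at h
      exact add_right_cancel h
    · rintro ⟨b, hb, rfl⟩
      have hτ : indVec τ ≤ b + indVec τ := le_add_self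
      refine ⟨hτ, b, hb, ?_⟩
      rw [← hind τ (hAnot τ hτ)]; abel
  have hAl : IsLowerSet A := by
    intro σ τ hστ hσ y
    have := hσ y
    rw [indVec_apply] at this ⊢
    by_cases hy : y ∈ τ
    · have hy' := hστ hy
      simpa [hy, hy'] using this
    · simp [hy]
  have hBl : IsLowerSet B := fun σ τ hστ hσ => hlow' (Finset.insert_subset_insert w hστ) hσ
  have hBc : AcyclicAt K B p := by
    refine acyclicAt_of_cone w fun τ hτ => ?_
    rw [hB, Set.mem_ofPred_eq, Finset.insert_idem]
    exact hτ
  have hAc : AcyclicAt K A p := by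
    by_cases h0 : a' = 0
    -- If `a' = 0`, then `A` consists of the empty face alone and is not acyclic at `0`; the total
    -- degree is then 1, which `1 ≤ r` rules out.
    · subst h0
      rw [hdeg] at hp
      simp at hp
      omega
    · obtain ⟨v, hv⟩ := Finsupp.ne_iff.1 h0
      refine acyclicAt_of_cone v fun τ hτ y => ?_
      have := hτ y
      rw [indVec_apply] at this ⊢
      by_cases hy : y = v
      · subst hy; simp at hv ⊢; omega
      · simpa [hy] using this
  rw [e1]
  cases p with
  | zero => exact acyclicAt_union_zero hAc hBc
  | succ p =>
    refine acyclicAt_union_succ hAl hBl hAc hBc ?_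
    rw [e2]
    refine h a' ?_ p ?_
    · rintro w' (rfl | hw')
      · exact ha'w
      · have := ha w' hw'
        simp only [Finsupp.add_apply] at this
        omega
    · rw [hdeg] at hp; push_cast at hp; omega

lemma RegLEOff.union_variables {r : ℤ} (hr : 1 ≤ r) (W : Finset V) (hU : IsUpperSet U)
    (h : RegLEOff K (W : Set V) U r) : RegLE K (U ∪ {b | ∃ w ∈ W, b w ≠ 0}) r := by
  induction W using Finset.induction_on generalizing U with
  | empty => simpa using h
  | insert w W _ ih =>
    rw [Finset.coe_insert] at h
    have h1 := ih (hU.union (by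
      have := isUpperSet_variables ({w} : Set V)
      simpa using this)) (h.union_variable hr hU)
    have e : U ∪ {b : V →₀ ℕ | ∃ w' ∈ insert w W, b w' ≠ 0} =
        U ∪ {b | b w ≠ 0} ∪ {b | ∃ w ∈ W, b w ≠ 0} := by
      ext b; simp [or_assoc]
    rw [e]
    exact h1

/-! ## Quadratic squarefree monomials -/

/-- The monomials divisible by `x_u x_v` for some `u`, `v` with `E u v`, where `x_u x_u` is read as
the variable `x_u`. -/
def edgeMonomials (E : V → V → Prop) : Set (V →₀ ℕ) :=
  {a | ∃ u v, E u v ∧ a u ≠ 0 ∧ a v ≠ 0}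

variable {E : V → V → Prop} {u v : V}

lemma isUpperSet_edgeMonomials : IsUpperSet (edgeMonomials E) := by
  rintro a b h ⟨u, v, huv, hu, hv⟩
  exact ⟨u, v, huv, fun h0 => hu (by have := h u; omega), fun h0 => hv (by have := h v; omega)⟩

lemma add_single_mem_edgeMonomials_iff (hE : ∀ ⦃x y⦄, E x y → E y x) (hu : ¬ E u u) {b : V →₀ ℕ} :
    b + Finsupp.single u 1 ∈ edgeMonomials E ↔ b ∈ edgeMonomials E ∨ ∃ x, E u x ∧ b x ≠ 0 := by
  constructor
  · rintro ⟨x, y, hxy, hx, hy⟩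
    simp only [Finsupp.add_apply, single_one_apply] at hx hy
    by_cases h1 : u = x
    · subst h1
      have h2 : u ≠ y := fun h2 => hu (h2 ▸ hxy)
      exact Or.inr ⟨y, hxy, by simpa [h2] using hy⟩
    · by_cases h2 : u = y
      · subst h2
        exact Or.inr ⟨x, hE hxy, by simpa [h1] using hx⟩
      · exact Or.inl ⟨x, y, hxy, by simpa [h1] using hx, by simpa [h2] using hy⟩
  · rintro (h | ⟨x, hx, hbx⟩)
    · exact isUpperSet_edgeMonomials le_self_add h
    · exact ⟨u, x, hx, by simp, by simp [hbx]⟩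

/-- Without loops at `u` and `v`, the quadric `x_u x_v` is a minimal generator: its upper Koszul
complex is `{∅}`, whose reduced homology in dimension `-1` is nonzero. -/
lemma two_le_of_regLE_edgeMonomials {r : ℤ} (huv : E u v) (hu : ¬ E u u)
    (hv : ¬ E v v) (h : RegLE K (edgeMonomials E) r) : 2 ≤ r := by
  by_contra! hr
  have hne : u ≠ v := fun h => hu (h ▸ huv)
  have hac := h (Finsupp.single u 1 + Finsupp.single v 1) (by simp) 0 (by
    rw [map_add, degree_single_one, degree_single_one]; simpa using hr)
  have hmem : ∀ τ, τ ∈ koszulComplex (edgeMonomials E) (Finsupp.single u 1 + Finsupp.single v 1) →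
      τ = ∅ := by
    rintro τ ⟨b, ⟨x, y, hxy, hx, hy⟩, hb⟩
    have key : ∀ z, b z + (if z ∈ τ then 1 else 0) =
        (if u = z then 1 else 0) + (if v = z then 1 else 0) := by
      intro z
      have := DFunLike.congr_fun hb z
      simpa only [Finsupp.add_apply, indVec_apply, single_one_apply] using this
    have hsub : ∀ z, b z ≠ 0 → z = u ∨ z = v := by
      intro z hz
      have := key z
      by_contra! hcon
      simp [Ne.symm hcon.1, Ne.symm hcon.2, hz] at this
    have hbu : b u ≠ 0 ∧ b v ≠ 0 := by
      rcases hsub x hx with rfl | rfl <;> rcases hsub y hy with rfl | rfl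
      · exact absurd hxy hu
      · exact ⟨hx, hy⟩
      · exact ⟨hy, hx⟩
      · exact absurd hxy hv
    ext z
    simp only [Finset.notMem_empty, iff_false]
    intro hz
    have := key z
    simp only [hz, if_true] at this
    by_cases h1 : u = z
    · subst h1; simp [Ne.symm hne, hbu.1] at this
    · by_cases h2 : v = z
      · subst h2; simp [hne, hbu.2] at this
      · simp [h1, h2] at this
  obtain ⟨c', hc', hd⟩ := hac (Pi.single ∅ 1) (by
    intro τ hτ
    by_cases h0 : τ = ∅
    · subst h0
      refine ⟨⟨Finsupp.single u 1 + Finsupp.single v 1, ⟨u, v, huv, by simp, by simp⟩, ?_⟩, rfl⟩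
      ext y; simp [indVec_apply]
    · simp [h0] at hτ) (by
    refine IsSimplicialChain.simplicialD_zero (Δ := Set.univ) ?_
    intro τ hτ
    by_cases h0 : τ = ∅
    · simp [h0]
    · simp [h0] at hτ)
  have hc0 : c' = 0 := by
    ext τ
    by_contra h0
    obtain ⟨h1, h2⟩ := hc' τ h0
    rw [hmem τ h1] at h2
    simp at h2
  have := congrFun hd ∅
  simp [hc0] at this

/-- Let `a` avoid all neighbours of `u` and `v`, hence also `u` and `v`. In multidegree `a + e_u +
e_v` the complex is the union of the simplex `A` on the support of `a` and the join `B` of the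
complex at `a` with the simplex on `{u, v}`. Both are acyclic and meet in the complex at `a`. The
degree rises by two and the dimension by one, which gains the `1` in `r - 1`. -/
lemma regLEOff_edgeMonomials_neighbors {r : ℤ} (hE : ∀ ⦃x y⦄, E x y → E y x) (huv : E u v) (hu : ¬ E u u)
    (hv : ¬ E v v) (h : RegLE K (edgeMonomials E) r) :
    RegLEOff K {x | E u x ∨ E v x} (edgeMonomials E) (r - 1) := by
  intro a ha p hp
  have hne : u ≠ v := fun h => hu (h ▸ huv)
  have hau : a u = 0 := ha u (Or.inr (hE huv))
  have hav : a v = 0 := ha v (Or.inl huv)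
  by_cases h0 : a = 0
  · subst h0
    refine acyclicAt_of_forall_notMem ?_
    rintro τ ⟨b, ⟨x, y, _, hx, _⟩, hb⟩
    have := DFunLike.congr_fun hb x
    rw [Finsupp.add_apply, Finsupp.zero_apply] at this
    omega
  set A : Set (Finset V) := {τ | indVec τ ≤ a} with hA
  set B : Set (Finset V) := {τ | (τ.erase u).erase v ∈ koszulComplex (edgeMonomials E) a} with hB
  have hKl := isLowerSet_koszulComplex (a := a) (isUpperSet_edgeMonomials (E := E))
  have hAn : ∀ τ ∈ A, u ∉ τ ∧ v ∉ τ := by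
    intro τ hτ
    constructor
    · intro h1
      have := hτ u
      simp [indVec_apply, h1, hau] at this
    · intro h1
      have := hτ v
      simp [indVec_apply, h1, hav] at this
  have hAl : IsLowerSet A := by
    intro σ τ hστ hσ y
    have := hσ y
    rw [indVec_apply] at this ⊢
    by_cases hy : y ∈ τ
    · have hy' := hστ hy
      simpa [hy, hy'] using this
    · simp [hy]
  have hBl : IsLowerSet B := fun σ τ hστ hσ =>
    hKl (Finset.erase_subset_erase _ (Finset.erase_subset_erase _ hστ)) hσ
  have hAc : AcyclicAt K A p := by
    obtain ⟨z, hz⟩ := Finsupp.ne_iff.1 h0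
    refine acyclicAt_of_cone z fun τ hτ y => ?_
    have := hτ y
    rw [indVec_apply] at this ⊢
    by_cases hy : y = z
    · subst hy; simp at hz ⊢; omega
    · simpa [hy] using this
  have hBc : AcyclicAt K B p := by
    refine acyclicAt_of_cone u fun τ hτ => ?_
    have : ((insert u τ).erase u).erase v = (τ.erase u).erase v := by
      ext y; simp only [Finset.mem_erase, Finset.mem_insert]; tauto
    rw [hB, Set.mem_ofPred_eq, this]
    exact hτ
  have e1 : A ∩ B = koszulComplex (edgeMonomials E) a := by
    ext τ
    constructor
    · rintro ⟨h1, h2⟩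
      obtain ⟨h3, h4⟩ := hAn τ h1
      rwa [hB, Set.mem_ofPred_eq, Finset.erase_eq_of_notMem h3, Finset.erase_eq_of_notMem h4] at h2
    · intro h1
      exact ⟨(mem_koszulComplex_iff.1 h1).1, hKl ((Finset.erase_subset _ _).trans
        (Finset.erase_subset _ _)) h1⟩
  have e2 : A ∪ B = koszulComplex (edgeMonomials E)
      (a + (Finsupp.single u 1 + Finsupp.single v 1)) := by
    ext τ
    constructor
    · rintro (hτ | ⟨b, hb, h⟩)
      · obtain ⟨h3, h4⟩ := hAn τ hτ
        refine mem_koszulComplex_iff.2 ⟨le_trans hτ le_self_add, u, v, huv, ?_, ?_⟩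
        · simp [indVec_apply, h3]
        · simp [indVec_apply, h4]
      · have key : ∀ z, b z + (if z ∈ (τ.erase u).erase v then 1 else 0) = a z := by
          intro z
          have := DFunLike.congr_fun h z
          simpa only [Finsupp.add_apply, indVec_apply] using this
        have hle : b + indVec τ ≤ a + (Finsupp.single u 1 + Finsupp.single v 1) := by
          intro z
          have := key z
          simp only [Finsupp.add_apply, indVec_apply, single_one_apply]
          simp only [Finset.mem_erase] at this
          by_cases h1 : z = u
          · subst h1
            simp only [if_true]
            split_ifs at this ⊢ <;> omega
          · by_cases h2 : z = v
            · subst h2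
              simp only [if_true]
              split_ifs at this ⊢ <;> omega
            · simp only [h1, h2, ne_eq, not_false_eq_true, true_and] at this
              omega
        refine mem_koszulComplex_iff.2 ⟨le_trans le_add_self hle,
          isUpperSet_edgeMonomials (le_tsub_of_add_le_right hle) hb⟩
    · rintro ⟨b, ⟨x, y, hxy, hx, hy⟩, h⟩
      have key : ∀ z, b z + (if z ∈ τ then 1 else 0) =
          a z + ((if u = z then 1 else 0) + (if v = z then 1 else 0)) := by
        intro z
        have := DFunLike.congr_fun h z
        simpa only [Finsupp.add_apply, indVec_apply, single_one_apply] using this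
      by_cases hτ : u ∉ τ ∧ v ∉ τ
      · left
        intro z
        have := key z
        rw [indVec_apply]
        by_cases hz : z ∈ τ
        · have h1 : u ≠ z := fun h => hτ.1 (h ▸ hz)
          have h2 : v ≠ z := fun h => hτ.2 (h ▸ hz)
          simp only [hz, h1, h2, if_true, if_false] at this ⊢
          omega
        · simp [hz]
      · right
        -- A face containing `u` or `v` removes one of these variables, so an edge dividing the
        -- quotient `b` cannot use `u` or `v`: its other end would be a neighbour outside `{u, v}`,
        -- absent from `b`. The edge therefore already occurs at `a`.
        have hnb : ∀ z, b z ≠ 0 → E u z ∨ E v z → z = u ∨ z = v := by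
          intro z hz hE'
          have h1 := key z
          rw [ha z hE'] at h1
          by_contra! hcon
          simp [Ne.symm hcon.1, Ne.symm hcon.2, hz] at h1
        have hzero : b u = 0 ∨ b v = 0 := by
          have h1 := key u
          have h2 := key v
          simp only [hau, hav, if_true, hne, Ne.symm hne, if_false] at h1 h2
          by_cases h3 : u ∈ τ
          · left; simp only [h3, if_true] at h1; omega
          · have h4 : v ∈ τ := by tauto
            right; simp only [h4, if_true] at h2; omega
        have hxy' : ∀ x y, E x y → b x ≠ 0 → b y ≠ 0 → x ≠ u ∧ x ≠ v := by
          intro x y hxy hx hy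
          constructor
          · rintro rfl
            rcases hnb y hy (Or.inl hxy) with rfl | rfl
            · exact hu hxy
            · tauto
          · rintro rfl
            rcases hnb y hy (Or.inr hxy) with rfl | rfl
            · tauto
            · exact hv hxy
        obtain ⟨hx1, hx2⟩ := hxy' x y hxy hx hy
        obtain ⟨hy1, hy2⟩ := hxy' y x (hE hxy) hy hx
        have hval : ∀ z, z ≠ u → z ≠ v →
            b z + (if z ∈ τ then 1 else 0) = a z := by
          intro z h1 h2
          have := key z
          simpa [Ne.symm h1, Ne.symm h2] using this
        have hsub : ∀ z, z ≠ u → z ≠ v → (a - indVec ((τ.erase u).erase v)) z = b z := by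
          intro z h1 h2
          have := hval z h1 h2
          simp only [Finsupp.tsub_apply, indVec_apply, Finset.mem_erase, h1, h2, ne_eq,
            not_false_eq_true, true_and]
          omega
        refine mem_koszulComplex_iff.2 ⟨?_, x, y, hxy, ?_, ?_⟩
        · intro z
          rw [indVec_apply]
          by_cases hz : z ∈ (τ.erase u).erase v
          · simp only [Finset.mem_erase] at hz
            have := hval z hz.2.1 hz.1
            simp only [hz.2.2, if_true] at this
            simp only [Finset.mem_erase, hz, ne_eq, not_false_eq_true, and_self, if_true]
            omega
          · simp [hz]
        · rw [hsub x hx1 hx2]; exact hx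
        · rw [hsub y hy1 hy2]; exact hy
  rw [← e1]
  refine acyclicAt_inter hAl hBl hAc hBc ?_
  rw [e2]
  refine h _ (by simp) (p + 1) ?_
  rw [map_add, map_add, degree_single_one, degree_single_one]
  push_cast
  omega

/-- The sum of the two colons is the original ideal plus the variables in `N(u) ∪ N(v)`, of
regularity at most `r - 1`. This is the bound that Mayer–Vietoris requires in order to control the
intersection by `r`. -/
lemma RegLE.colon_edge {r : ℤ} (hE : ∀ ⦃x y⦄, E x y → E y x) (huv : E u v) (hu : ¬ E u u)
    (hv : ¬ E v v) (h : RegLE K (edgeMonomials E) r) :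
    RegLE K ({b | b + Finsupp.single u 1 ∈ edgeMonomials E} ∩
      {b | b + Finsupp.single v 1 ∈ edgeMonomials E}) r := by
  classical
  have hr := two_le_of_regLE_edgeMonomials huv hu hv h
  have hun : RegLE K ({b | b + Finsupp.single u 1 ∈ edgeMonomials E} ∪
      {b | b + Finsupp.single v 1 ∈ edgeMonomials E}) (r - 1) := by
    have h1 := RegLEOff.union_variables (by omega : 1 ≤ r - 1)
      (Finset.univ.filter fun x => E u x ∨ E v x) isUpperSet_edgeMonomials
      (by simpa using regLEOff_edgeMonomials_neighbors hE huv hu hv h)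
    convert h1 using 1
    ext b
    simp only [Set.mem_union, Set.mem_ofPred_eq, add_single_mem_edgeMonomials_iff hE hu,
      add_single_mem_edgeMonomials_iff hE hv, Finset.mem_filter, Finset.mem_univ, true_and]
    constructor
    · rintro ((h | ⟨x, hx, hb⟩) | (h | ⟨x, hx, hb⟩))
      · exact Or.inl h
      · exact Or.inr ⟨x, Or.inl hx, hb⟩
      · exact Or.inl h
      · exact Or.inr ⟨x, Or.inr hx, hb⟩
    · rintro (h | ⟨x, hx | hx, hb⟩)
      · exact Or.inl (Or.inl h)
      · exact Or.inl (Or.inr ⟨x, hx, hb⟩)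
      · exact Or.inr (Or.inr ⟨x, hx, hb⟩)
  have hup : ∀ x : V, IsUpperSet {b | b + Finsupp.single x 1 ∈ edgeMonomials E} := fun x =>
    isUpperSet_colon isUpperSet_edgeMonomials _
  intro a ha p hp
  rw [koszulComplex_inter]
  refine acyclicAt_inter (isLowerSet_koszulComplex (hup u)) (isLowerSet_koszulComplex (hup v))
    (h.colon_variable isUpperSet_edgeMonomials u a ha p hp)
    (h.colon_variable isUpperSet_edgeMonomials v a ha p hp) ?_
  rw [← koszulComplex_union]
  exact hun a ha (p + 1) (by push_cast; omega)

end Koszul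

/-! ## Products of edges and vertex covers -/

section EdgeProducts

variable {V : Type*} {ι : Type*} [Fintype ι]

/-- The exponent of the monomial `∏ x_{d l}`. -/
def prodVec (d : ι → V) : V →₀ ℕ := ∑ l, Finsupp.single (d l) 1

open Classical in
lemma prodVec_apply (d : ι → V) (x : V) :
    prodVec d x = (Finset.univ.filter fun l => d l = x).card := by
  simp [prodVec, Finsupp.finsetSum_apply, Finsupp.single_apply]

lemma prodVec_comp_equiv (d : ι → V) (π : ι ≃ ι) : prodVec (d ∘ π) = prodVec d := by
  unfold prodVec
  exact Equiv.sum_comp π fun l => Finsupp.single (d l) 1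

open Classical in
-- Equal exponents mean equally large fibres over each vertex; bijections of the fibres are glued
-- together.
lemma exists_equiv_of_prodVec_eq {c c' : ι → V} (h : prodVec c = prodVec c') :
    ∃ π : ι ≃ ι, ∀ l, c' (π l) = c l := by
  have hc : ∀ x, Nonempty ({l // c l = x} ≃ {l // c' l = x}) := by
    intro x
    refine ⟨Fintype.equivOfCardEq ?_⟩
    have := DFunLike.congr_fun h x
    rwa [prodVec_apply, prodVec_apply, ← Fintype.card_subtype, ← Fintype.card_subtype] at this
  have e : ∀ x, {l // c l = x} ≃ {l // c' l = x} := fun x => (hc x).some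
  refine ⟨(Equiv.sigmaFiberEquiv c).symm.trans
    ((Equiv.sigmaCongrRight e).trans (Equiv.sigmaFiberEquiv c')), fun l => ?_⟩
  simp [Equiv.sigmaFiberEquiv]
  exact (e (c l) ⟨l, rfl⟩).2

open Classical in
lemma prodVec_update (d : ι → V) (l : ι) (x : V) :
    prodVec (Function.update d l x) + Finsupp.single (d l) 1 =
      prodVec d + Finsupp.single x 1 := by
  unfold prodVec
  rw [← Finset.add_sum_erase _ _ (Finset.mem_univ l),
    ← Finset.add_sum_erase _ (fun i => Finsupp.single (d i) 1) (Finset.mem_univ l)]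
  have : ∑ i ∈ Finset.univ.erase l, (Finsupp.single (Function.update d l x i) 1 : V →₀ ℕ) =
      ∑ i ∈ Finset.univ.erase l, Finsupp.single (d i) 1 := by
    refine Finset.sum_congr rfl fun i hi => ?_
    rw [Function.update_of_ne (Finset.ne_of_mem_erase hi)]
  rw [this, Function.update_self]
  abel

open Classical in
-- An augmenting-path argument. Some position `l` has `d l = x` and `d' l ≠ x`; change `d' l` to
-- `x`. If the displaced vertex was in excess in `d'`, stop. Otherwise it is now deficient and takes
-- over the role of `x`, with one disagreement fewer.
lemma exists_exchange (d : ι → V) : ∀ (n : ℕ) (d' : ι → V) (x : V),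
    (Finset.univ.filter fun l => d l ≠ d' l).card = n → prodVec d' x < prodVec d x →
    ∃ (d'' : ι → V) (y : V), (∀ l, d'' l = d l ∨ d'' l = d' l) ∧ prodVec d y < prodVec d' y ∧
      prodVec d'' + Finsupp.single y 1 = prodVec d' + Finsupp.single x 1 := by
  intro n
  induction n with
  | zero =>
    intro d' x hn hx
    have : d = d' := by
      ext l
      by_contra hl
      rw [Finset.card_eq_zero] at hn
      have : l ∈ Finset.univ.filter fun l => d l ≠ d' l := by simpa using hl
      rw [hn] at this
      simp at this
    rw [this] at hx
    exact absurd hx (lt_irrefl _)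
  | succ n ih =>
    intro d' x hn hx
    obtain ⟨l, hl, hl'⟩ : ∃ l, d l = x ∧ d' l ≠ x := by
      by_contra! hcon
      rw [prodVec_apply, prodVec_apply] at hx
      refine absurd hx (not_lt.2 (Finset.card_le_card fun l hl => ?_))
      simp only [Finset.mem_filter, Finset.mem_univ, true_and] at hl ⊢
      exact hcon l hl
    have hup := prodVec_update d' l x
    by_cases hz : prodVec d (d' l) < prodVec d' (d' l)
    · refine ⟨Function.update d' l x, d' l, fun i => ?_, hz, hup⟩
      by_cases hi : i = l
      · subst hi; left; simp [hl]
      · right; simp [hi]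
    · have hupz := DFunLike.congr_fun hup (d' l)
      simp only [Finsupp.add_apply, Finsupp.single_apply, if_true, if_neg (Ne.symm hl')] at hupz
      have hcard : (Finset.univ.filter fun i => d i ≠ Function.update d' l x i).card = n := by
        have : (Finset.univ.filter fun i => d i ≠ Function.update d' l x i) =
            (Finset.univ.filter fun i => d i ≠ d' i).erase l := by
          ext i
          by_cases hi : i = l
          · subst hi; simp [hl]
          · simp [hi]
        rw [this, Finset.card_erase_of_mem (by simpa [hl] using Ne.symm hl'), hn]
        rfl
      obtain ⟨d'', y, h1, h2, h3⟩ := ih (Function.update d' l x) (d' l) hcard (by omega)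
      refine ⟨d'', y, fun i => ?_, ?_, ?_⟩
      · rcases h1 i with h | h
        · exact Or.inl h
        · by_cases hi : i = l
          · subst hi; left; rw [h]; simp [hl]
          · right; rw [h]; simp [hi]
      · have hupy := DFunLike.congr_fun hup y
        have hupx := DFunLike.congr_fun hup x
        simp only [Finsupp.add_apply, Finsupp.single_apply, if_true, if_neg hl'] at hupy hupx
        by_cases hy : x = y
        · subst hy; omega
        · simp only [if_neg hy] at hupy; omega
      · rw [h3, hup]

end EdgeProducts

/-! ### Vertex covers and the monomials of ordinary and symbolic powers. -/

section Covers

variable {V : Type*} (G : SimpleGraph V)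

/-- The exponents of the products of `s` edges. -/
def IsEdgeProduct (s : ℕ) (m : V →₀ ℕ) : Prop :=
  ∃ u v : Fin s → V, (∀ l, G.Adj (u l) (v l)) ∧ m = prodVec u + prodVec v

/-- The monomials of the `s`-th power of the edge ideal. -/
def powerMonomials (s : ℕ) : Set (V →₀ ℕ) := {a | ∃ m, IsEdgeProduct G s m ∧ m ≤ a}

/-- The monomials of the `t`-th symbolic power of the edge ideal. -/
def symbolicMonomials (t : ℕ) : Set (V →₀ ℕ) :=
  {a | ∀ C : Finset V, G.IsVertexCover C → t ≤ ∑ x ∈ C, a x}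

lemma isUpperSet_symbolicMonomials (t : ℕ) : IsUpperSet (symbolicMonomials G t) :=
  fun _ _ h ha C hC => (ha C hC).trans (Finset.sum_le_sum fun x _ => h x)

variable {G} {s : ℕ}

lemma degree_prodVec (u : Fin s → V) : (prodVec u).degree = s := by
  simp [prodVec, map_sum, Finsupp.degree_single]

lemma IsEdgeProduct.degree_eq {m : V →₀ ℕ} (h : IsEdgeProduct G s m) : m.degree = 2 * s := by
  obtain ⟨u, v, _, rfl⟩ := h
  rw [map_add, degree_prodVec, degree_prodVec]; ring

open Classical in
lemma sum_prodVec (C : Finset V) (u : Fin s → V) :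
    ∑ x ∈ C, prodVec u x = ∑ l, if u l ∈ C then 1 else 0 := by
  simp only [prodVec, Finsupp.finsetSum_apply, Finsupp.single_apply]
  rw [Finset.sum_comm]
  refine Finset.sum_congr rfl fun l _ => ?_
  simp

lemma le_sum_edgeProduct {C : Finset V} (hC : G.IsVertexCover C) {u v : Fin s → V}
    (h : ∀ l, G.Adj (u l) (v l)) : s ≤ ∑ x ∈ C, (prodVec u + prodVec v) x := by
  classical
  simp only [Finsupp.add_apply, Finset.sum_add_distrib, sum_prodVec]
  rw [← Finset.sum_add_distrib]
  calc s = ∑ l : Fin s, 1 := by simp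
    _ ≤ _ := Finset.sum_le_sum fun l _ => by
      rcases hC (h l) with h1 | h1
      · have : u l ∈ C := by simpa using h1
        simp [this]
      · have : v l ∈ C := by simpa using h1
        simp [this]

/-- Each edge contributes 1 or 2 to the weight on a cover, and 2 exactly when both of its ends are
covered. -/
lemma sum_edgeProduct_eq_iff {C : Finset V} (hC : G.IsVertexCover C) {u v : Fin s → V}
    (h : ∀ l, G.Adj (u l) (v l)) :
    ∑ x ∈ C, (prodVec u + prodVec v) x ≤ s ↔ ∀ l, ¬ (u l ∈ C ∧ v l ∈ C) := by
  classical
  simp only [Finsupp.add_apply, Finset.sum_add_distrib, sum_prodVec]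
  rw [← Finset.sum_add_distrib]
  have h1 : ∀ l, 1 ≤ ((if u l ∈ C then 1 else 0) + if v l ∈ C then 1 else 0 : ℕ) := by
    intro l
    rcases hC (h l) with h1 | h1
    · have : u l ∈ C := by simpa using h1
      simp [this]
    · have : v l ∈ C := by simpa using h1
      simp [this]
  constructor
  · rintro hs l ⟨hu, hv⟩
    have : ∑ l : Fin s, 1 < ∑ l, ((if u l ∈ C then 1 else 0) + if v l ∈ C then 1 else 0 : ℕ) :=
      Finset.sum_lt_sum (fun l _ => h1 l) ⟨l, Finset.mem_univ _, by simp [hu, hv]⟩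
    simp at this
    simp only [Finset.sum_add_distrib] at this hs
    omega
  · intro hn
    calc _ ≤ ∑ l : Fin s, 1 := Finset.sum_le_sum fun l _ => by
          have := hn l
          split_ifs <;> simp_all
      _ = s := by simp

/-- An edge product that meets the cover `C` minimally splits into its part on `C` and its part
off `C`. -/
lemma exists_split_of_sum_le {C : Finset V} (hC : G.IsVertexCover C) {m : V →₀ ℕ}
    (hm : IsEdgeProduct G s m) (hs : ∑ x ∈ C, m x ≤ s) :
    ∃ c d : Fin s → V, (∀ l, G.Adj (c l) (d l)) ∧ (∀ l, c l ∈ C) ∧ (∀ l, d l ∉ C) ∧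
      m = prodVec c + prodVec d := by
  classical
  obtain ⟨u, v, huv, rfl⟩ := hm
  have h := (sum_edgeProduct_eq_iff hC huv).1 hs
  have hc : ∀ l, u l ∈ C ∨ v l ∈ C := fun l => by simpa using hC (huv l)
  refine ⟨fun l => if u l ∈ C then u l else v l, fun l => if u l ∈ C then v l else u l,
    fun l => ?_, fun l => ?_, fun l => ?_, ?_⟩
  · dsimp only
    split_ifs
    · exact huv l
    · exact (huv l).symm
  · dsimp only
    split_ifs with h1
    · exact h1
    · exact (hc l).resolve_left h1
  · dsimp only
    split_ifs with h1
    · exact fun h2 => h l ⟨h1, h2⟩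
    · exact h1
  · unfold prodVec
    rw [← Finset.sum_add_distrib, ← Finset.sum_add_distrib]
    refine Finset.sum_congr rfl fun l _ => ?_
    dsimp only
    split_ifs
    · rfl
    · rw [add_comm]

/-- The exchange property of products of edges modulo the symbolic power. -/
lemma exists_edgeProduct_exchange {C : Finset V} (hC : G.IsVertexCover C) {m m' : V →₀ ℕ}
    (hm : IsEdgeProduct G s m) (hm' : IsEdgeProduct G s m') (hs : ∑ x ∈ C, (m ⊔ m') x ≤ s)
    {x : V} (hx : m' x < m x) :
    ∃ m'' y, IsEdgeProduct G s m'' ∧ m y < m' y ∧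
      m'' + Finsupp.single y 1 = m' + Finsupp.single x 1 := by
  classical
  have hle : ∑ x ∈ C, m x ≤ ∑ x ∈ C, (m ⊔ m') x :=
    Finset.sum_le_sum fun x _ => by simp
  have hle' : ∑ x ∈ C, m' x ≤ ∑ x ∈ C, (m ⊔ m') x :=
    Finset.sum_le_sum fun x _ => by simp
  have hge : s ≤ ∑ x ∈ C, m x := by
    obtain ⟨u, v, huv, rfl⟩ := hm; exact le_sum_edgeProduct hC huv
  have hge' : s ≤ ∑ x ∈ C, m' x := by
    obtain ⟨u, v, huv, rfl⟩ := hm'; exact le_sum_edgeProduct hC huv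
  -- Both products have weight at least `s` on `C` and their lcm has weight at most `s`, so all
  -- three agree on `C`.
  have heq : ∀ z ∈ C, m z = (m ⊔ m') z :=
    (Finset.sum_eq_sum_iff_of_le fun x _ => by simp).1 (by omega)
  have heq' : ∀ z ∈ C, m' z = (m ⊔ m') z :=
    (Finset.sum_eq_sum_iff_of_le fun x _ => by simp).1 (by omega)
  obtain ⟨c, d, hcd, hc, hd, rfl⟩ := exists_split_of_sum_le hC hm (by omega)
  obtain ⟨c', d', hcd', hc', hd', rfl⟩ := exists_split_of_sum_le hC hm' (by omega)
  have hz1 : ∀ (e : Fin s → V), (∀ l, e l ∉ C) → ∀ z ∈ C, prodVec e z = 0 := by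
    intro e he z hz
    rw [prodVec_apply, Finset.card_eq_zero, Finset.filter_eq_empty_iff]
    intro l _ h
    exact he l (h ▸ hz)
  have hz2 : ∀ (e : Fin s → V), (∀ l, e l ∈ C) → ∀ z ∉ C, prodVec e z = 0 := by
    intro e he z hz
    rw [prodVec_apply, Finset.card_eq_zero, Finset.filter_eq_empty_iff]
    intro l _ h
    exact hz (h ▸ he l)
  have hcc : prodVec c' = prodVec c := by
    ext z
    by_cases hz : z ∈ C
    · have h1 := (heq' z hz).trans (heq z hz).symm
      rw [Finsupp.add_apply, Finsupp.add_apply, hz1 d hd z hz, hz1 d' hd' z hz] at h1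
      omega
    · rw [hz2 c hc z hz, hz2 c' hc' z hz]
  -- After reindexing, both products use the same end `c' l` in `C` at position `l`, so any mixture
  -- of `d ∘ π` and `d'` still consists of edges.
  obtain ⟨π, hπ⟩ := exists_equiv_of_prodVec_eq hcc
  rw [hcc, Finsupp.add_apply, Finsupp.add_apply] at hx
  obtain ⟨d'', y, h1, h2, h3⟩ := exists_exchange (d ∘ π) _ d' x rfl
    (by rw [prodVec_comp_equiv]; omega)
  rw [prodVec_comp_equiv] at h2
  refine ⟨prodVec c' + prodVec d'', y, ⟨c', d'', fun l => ?_, rfl⟩, ?_, ?_⟩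
  · rcases h1 l with h | h
    · rw [h, ← hπ l]; exact hcd _
    · rw [h]; exact hcd' l
  · rw [hcc, Finsupp.add_apply, Finsupp.add_apply]; omega
  · rw [add_assoc, h3, add_assoc]

end Covers

/-! ## Colon ideals by products of edges -/

section Colon

variable {V : Type*} [LinearOrder V] [Fintype V] {K : Type*} [Field K] {G : SimpleGraph V}

/-- The monomials meeting every vertex cover that contains exactly one endpoint of each of the edges
`u l, v l`, for `l ∈ A`. -/
def transversalMonomials (G : SimpleGraph V) {s : ℕ} (u v : Fin s → V) (A : Finset (Fin s)) :
    Set (V →₀ ℕ) :=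
  {b | ∀ C : Finset V, G.IsVertexCover C → (∀ l ∈ A, ¬ (u l ∈ C ∧ v l ∈ C)) → ∃ x ∈ C, b x ≠ 0}

lemma transversalMonomials_empty {s : ℕ} (u v : Fin s → V) :
    transversalMonomials G u v ∅ = edgeMonomials G.Adj := by
  ext b
  constructor
  · intro h
    by_contra hcon
    obtain ⟨x, hx, hb⟩ := h (Finset.univ.filter fun x => b x = 0) (by
      intro x y hxy
      by_contra! hn
      simp only [Finset.coe_filter, Finset.mem_univ, true_and, Set.mem_ofPred] at hn
      exact hcon ⟨x, y, hxy, hn.1, hn.2⟩) (by simp)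
    simp at hx
    exact hb hx
  · rintro ⟨x, y, hxy, hx, hy⟩ C hC _
    rcases hC hxy with h | h
    · exact ⟨x, by simpa using h, hx⟩
    · exact ⟨y, by simpa using h, hy⟩

lemma add_single_mem_transversalMonomials_iff {s : ℕ} {u v : Fin s → V} {A : Finset (Fin s)}
    {b : V →₀ ℕ} {z : V} : b + Finsupp.single z 1 ∈ transversalMonomials G u v A ↔
      ∀ C : Finset V, G.IsVertexCover C → (∀ l ∈ A, ¬ (u l ∈ C ∧ v l ∈ C)) →
        z ∈ C ∨ ∃ x ∈ C, b x ≠ 0 := by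
  refine forall_congr' fun C => forall_congr' fun _ => forall_congr' fun _ => ?_
  constructor
  · rintro ⟨x, hx, hb⟩
    by_cases hz : z = x
    · subst hz; exact Or.inl hx
    · exact Or.inr ⟨x, hx, by simpa [single_one_apply, hz] using hb⟩
  · rintro (hz | ⟨x, hx, hb⟩)
    · exact ⟨z, hz, by simp⟩
    · exact ⟨x, hx, by simp [hb]⟩

/-- A cover not containing both ends of the new edge misses `u l` or misses `v l`; taking the colon
by a variable means testing only the covers that miss it. -/
lemma transversalMonomials_insert {s : ℕ} (u v : Fin s → V) (A : Finset (Fin s)) (l : Fin s) :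
    transversalMonomials G u v (insert l A) =
      {b | b + Finsupp.single (u l) 1 ∈ transversalMonomials G u v A} ∩
      {b | b + Finsupp.single (v l) 1 ∈ transversalMonomials G u v A} := by
  ext b
  simp only [Set.mem_inter_iff, Set.mem_ofPred_eq, add_single_mem_transversalMonomials_iff]
  constructor
  · intro h
    constructor
    · intro C hC hA
      by_cases hu : u l ∈ C
      · exact Or.inl hu
      · refine Or.inr (h C hC fun i hi => ?_)
        rcases Finset.mem_insert.1 hi with rfl | hi
        · exact fun h' => hu h'.1
        · exact hA i hi
    · intro C hC hA
      by_cases hu : v l ∈ C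
      · exact Or.inl hu
      · refine Or.inr (h C hC fun i hi => ?_)
        rcases Finset.mem_insert.1 hi with rfl | hi
        · exact fun h' => hu h'.2
        · exact hA i hi
  · rintro ⟨h1, h2⟩ C hC hA
    have hA' : ∀ i ∈ A, ¬ (u i ∈ C ∧ v i ∈ C) := fun i hi => hA i (Finset.mem_insert_of_mem hi)
    rcases h1 C hC hA' with h3 | h3
    · rcases h2 C hC hA' with h4 | h4
      · exact absurd ⟨h3, h4⟩ (hA l (Finset.mem_insert_self _ _))
      · exact h4
    · exact h3

lemma regLE_univ {r : ℤ} (hr : 0 ≤ r) : RegLE K (Set.univ : Set (V →₀ ℕ)) r := by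
  intro a _ p hp
  have h0 : a ≠ 0 := by
    rintro rfl
    simp at hp
    omega
  obtain ⟨z, hz⟩ := Finsupp.ne_iff.1 h0
  refine acyclicAt_of_cone z fun τ hτ => mem_koszulComplex_iff.2 ⟨fun y => ?_, trivial⟩
  have := (mem_koszulComplex_iff.1 hτ).1 y
  rw [indVec_apply] at this ⊢
  by_cases hy : y = z
  · subst hy; simp at hz ⊢; omega
  · simpa [hy] using this

/-- The induction carries the shape of the ideal as well: either the unit ideal, or generated by the
edges of a relation containing `G`, with loops standing for variables. A loop at an end of the next
edge makes that colon the unit ideal; otherwise `RegLE.colon_edge` applies. -/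
lemma regLE_transversalMonomials {r : ℤ} (hr : 0 ≤ r) (h : RegLE K (edgeMonomials G.Adj) r) {s : ℕ}
    {u v : Fin s → V} (huv : ∀ l, G.Adj (u l) (v l)) (A : Finset (Fin s)) :
    RegLE K (transversalMonomials G u v A) r := by
  suffices H : RegLE K (transversalMonomials G u v A) r ∧
      (transversalMonomials G u v A = Set.univ ∨ ∃ E : V → V → Prop,
        (∀ ⦃x y⦄, E x y → E y x) ∧ (∀ x y, G.Adj x y → E x y) ∧
        transversalMonomials G u v A = edgeMonomials E) from H.1
  induction A using Finset.induction_on with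
  | empty =>
    rw [transversalMonomials_empty]
    exact ⟨h, Or.inr ⟨G.Adj, fun _ _ h => h.symm, fun _ _ h => h, rfl⟩⟩
  | insert l A _ ih =>
    obtain ⟨hreg, hA | ⟨E, hE, hG, hA⟩⟩ := ih
    · have : transversalMonomials G u v (insert l A) = Set.univ := by
        rw [transversalMonomials_insert, hA]; ext b; simp
      rw [this]
      exact ⟨regLE_univ hr, Or.inl rfl⟩
    · rw [transversalMonomials_insert, hA]
      rw [hA] at hreg
      have hun : ∀ z, E z z → {b | b + Finsupp.single z 1 ∈ edgeMonomials E} = Set.univ := by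
        intro z hz
        ext b
        simp only [Set.mem_ofPred_eq, Set.mem_univ, iff_true]
        exact ⟨z, z, hz, by simp, by simp⟩
      have hone : ∀ z, ¬ E z z → {b | b + Finsupp.single z 1 ∈ edgeMonomials E} =
          edgeMonomials fun x y => E x y ∨ (x = y ∧ E z x) := by
        intro z hz
        ext b
        rw [Set.mem_ofPred_eq, add_single_mem_edgeMonomials_iff hE hz]
        constructor
        · rintro (⟨x, y, hxy, hx, hy⟩ | ⟨x, hx, hb⟩)
          · exact ⟨x, y, Or.inl hxy, hx, hy⟩
          · exact ⟨x, x, Or.inr ⟨rfl, hx⟩, hb, hb⟩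
        · rintro ⟨x, y, hxy | ⟨_, hxz⟩, hx, hy⟩
          · exact Or.inl ⟨x, y, hxy, hx, hy⟩
          · exact Or.inr ⟨x, hxz, hx⟩
      have hfin : ∀ z, ¬ E z z → RegLE K {b | b + Finsupp.single z 1 ∈ edgeMonomials E} r ∧
          ({b | b + Finsupp.single z 1 ∈ edgeMonomials E} = Set.univ ∨ ∃ E' : V → V → Prop,
            (∀ ⦃x y⦄, E' x y → E' y x) ∧ (∀ x y, G.Adj x y → E' x y) ∧
            {b | b + Finsupp.single z 1 ∈ edgeMonomials E} = edgeMonomials E') := by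
        intro z hz
        refine ⟨hreg.colon_variable isUpperSet_edgeMonomials z, Or.inr ⟨_, ?_, ?_, hone z hz⟩⟩
        · rintro x y (h | ⟨rfl, h⟩)
          · exact Or.inl (hE h)
          · exact Or.inr ⟨rfl, h⟩
        · exact fun x y h => Or.inl (hG x y h)
      by_cases hu : E (u l) (u l)
      · rw [hun _ hu, Set.univ_inter]
        by_cases hv : E (v l) (v l)
        · rw [hun _ hv]
          exact ⟨regLE_univ hr, Or.inl rfl⟩
        · exact hfin _ hv
      · by_cases hv : E (v l) (v l)
        · rw [hun _ hv, Set.inter_univ]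
          exact hfin _ hu
        -- The new generators are the products of a neighbour of `u l` and a neighbour of `v l`; a
        -- common neighbour yields a loop, that is, a variable.
        · refine ⟨hreg.colon_edge hE (hG _ _ (huv l)) hu hv, Or.inr
            ⟨fun x y => E x y ∨ (E (u l) x ∧ E (v l) y) ∨ (E (v l) x ∧ E (u l) y), ?_, ?_, ?_⟩⟩
          · rintro x y (h | ⟨h1, h2⟩ | ⟨h1, h2⟩)
            · exact Or.inl (hE h)
            · exact Or.inr (Or.inr ⟨h2, h1⟩)
            · exact Or.inr (Or.inl ⟨h2, h1⟩)
          · exact fun x y h => Or.inl (hG x y h)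
          · ext b
            rw [Set.mem_inter_iff, Set.mem_ofPred_eq, Set.mem_ofPred_eq,
              add_single_mem_edgeMonomials_iff hE hu, add_single_mem_edgeMonomials_iff hE hv]
            constructor
            · rintro ⟨⟨x, y, hxy, hx, hy⟩ | ⟨x, hx, hbx⟩, h2⟩
              · exact ⟨x, y, Or.inl hxy, hx, hy⟩
              · rcases h2 with ⟨x, y, hxy, hx, hy⟩ | ⟨y, hy, hby⟩
                · exact ⟨x, y, Or.inl hxy, hx, hy⟩
                · exact ⟨x, y, Or.inr (Or.inl ⟨hx, hy⟩), hbx, hby⟩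
            · rintro ⟨x, y, h | ⟨h1, h2⟩ | ⟨h1, h2⟩, hx, hy⟩
              · exact ⟨Or.inl ⟨x, y, h, hx, hy⟩, Or.inl ⟨x, y, h, hx, hy⟩⟩
              · exact ⟨Or.inr ⟨x, h1, hx⟩, Or.inr ⟨y, h2, hy⟩⟩
              · exact ⟨Or.inr ⟨y, h2, hy⟩, Or.inr ⟨x, h1, hx⟩⟩

/-- The product already has weight at least `s` on every cover. A condition on `b` remains only
where the weight is exactly `s`, and there it asks for one more unit. -/
lemma symbolicMonomials_colon {s : ℕ} {u v : Fin s → V} (huv : ∀ l, G.Adj (u l) (v l)) :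
    {b | b + (prodVec u + prodVec v) ∈ symbolicMonomials G (s + 1)} =
      transversalMonomials G u v Finset.univ := by
  ext b
  refine forall_congr' fun C => forall_congr' fun hC => ?_
  have h1 := le_sum_edgeProduct hC huv
  have h2 := sum_edgeProduct_eq_iff hC huv
  have h3 : ∑ x ∈ C, (b + (prodVec u + prodVec v)) x =
      ∑ x ∈ C, b x + ∑ x ∈ C, (prodVec u + prodVec v) x := by
    rw [← Finset.sum_add_distrib]; rfl
  rw [h3]
  simp only [Finset.mem_univ, true_implies]
  rw [← h2]
  have h4 : (∃ x ∈ C, b x ≠ 0) ↔ 1 ≤ ∑ x ∈ C, b x := by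
    rw [Nat.one_le_iff_ne_zero, Ne, Finset.sum_eq_zero_iff]
    push Not
    rfl
  rw [h4]
  constructor
  · intro h h5; omega
  · intro h
    by_cases h5 : ∑ x ∈ C, (prodVec u + prodVec v) x ≤ s
    · have := h h5; omega
    · omega

/-- Linear quotients modulo the symbolic power: if `m'` divides `b + m` and the lcm of `m` and `m'`
lies outside the symbolic power, exchanging at the first place `x` where they differ gives a product
`m'' = m + e_x - e_y` that is lexicographically larger than `m`. Then `x_x` is in the colon and
divides `b`. -/
lemma setOf_add_mem_symbolicMonomials_union {s : ℕ} {A : Finset (Lex (V →₀ ℕ))}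
    {m : Lex (V →₀ ℕ)} (hm : IsEdgeProduct G s (ofLex m))
    (hA : ∀ m' ∈ A, IsEdgeProduct G s (ofLex m') ∧ m < m')
    (hA' : ∀ m', IsEdgeProduct G s (ofLex m') → m < m' → m' ∈ A) :
    {b | b + ofLex m ∈ symbolicMonomials G (s + 1) ∪ {a | ∃ m' ∈ A, ofLex m' ≤ a}} =
      {b | b + ofLex m ∈ symbolicMonomials G (s + 1)} ∪
        {b | ∃ w ∈ {w | Finsupp.single w 1 + ofLex m ∈
          symbolicMonomials G (s + 1) ∪ {a | ∃ m' ∈ A, ofLex m' ≤ a}}, b w ≠ 0} := by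
  have hup : IsUpperSet (symbolicMonomials G (s + 1) ∪ {a | ∃ m' ∈ A, ofLex m' ≤ a}) := by
    refine (isUpperSet_symbolicMonomials G _).union ?_
    rintro a b h ⟨m', hm', h'⟩
    exact ⟨m', hm', h'.trans h⟩
  ext b
  constructor
  · intro hb
    by_cases hb' : b + ofLex m ∈ symbolicMonomials G (s + 1)
    · exact Or.inl hb'
    obtain ⟨m', hm'A, hle⟩ := hb.resolve_left hb'
    obtain ⟨hm', hlt⟩ := hA m' hm'A
    have hsup : ofLex m' ⊔ ofLex m ∉ symbolicMonomials G (s + 1) := fun h =>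
      hb' (isUpperSet_symbolicMonomials G _ (sup_le hle le_add_self) h)
    simp only [symbolicMonomials, Set.mem_ofPred_eq, not_forall, not_le] at hsup
    obtain ⟨C, hC, hlt'⟩ := hsup
    obtain ⟨x, hx, hxlt⟩ := Finsupp.Lex.lt_iff.1 hlt
    obtain ⟨m'', y, hm'', hy, he⟩ := exists_edgeProduct_exchange hC hm' hm
      (Nat.lt_succ_iff.1 hlt') hxlt
    have hyx : y ≠ x := by
      rintro rfl
      exact absurd hy (not_lt.2 hxlt.le)
    have hval : ∀ z, m'' z + (if y = z then 1 else 0) = ofLex m z + if x = z then 1 else 0 := by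
      intro z
      have := DFunLike.congr_fun he z
      simpa [single_one_apply] using this
    -- As `m` and `m'` agree before `x`, the vertex `y` comes after `x`, so passing to `m''` first
    -- changes `m` at `x`, by an increase.
    have hlt'' : m < toLex m'' := by
      refine Finsupp.Lex.lt_iff.2 ⟨x, fun z hz => ?_, ?_⟩
      · have h1 := hval z
        have h2 : y ≠ z := by
          rintro rfl
          exact absurd hy (by rw [← hx y hz]; exact lt_irrefl _)
        simp only [h2, hz.ne', if_false] at h1
        simpa using h1.symm
      · have h1 := hval x
        simp only [hyx, if_false, if_true] at h1
        change ofLex m x < m'' x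
        omega
    refine Or.inr ⟨x, Or.inr ⟨toLex m'', hA' _ hm'' hlt'', ?_⟩, ?_⟩
    · change m'' ≤ _
      rw [add_comm, ← he]
      exact le_self_add
    · have h1 := hle x
      rw [Finsupp.add_apply] at h1
      omega
  · rintro (hb | ⟨w, hw, hbw⟩)
    · exact Or.inl hb
    · refine hup (add_le_add_left ?_ _) hw
      simpa using Nat.one_le_iff_ne_zero.2 hbw

/-- The set `A` of products still present is upward closed in the lexicographic order; its minimum
is removed at each step, starting from all products and ending with none. Since `1 ≤ s`, a product
contains an edge, which forces `2 ≤ r`. -/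
theorem regLE_symbolicMonomials {r : ℤ} {s : ℕ} (hs : 1 ≤ s) (h1 : RegLE K (edgeMonomials G.Adj) r)
    (h2 : RegLE K (symbolicMonomials G (s + 1) ∪ powerMonomials G s) (r + 2 * s)) :
    RegLE K (symbolicMonomials G (s + 1)) (r + 2 * s) := by
  classical
  have key : ∀ A : Finset (Lex (V →₀ ℕ)), (∀ m ∈ A, IsEdgeProduct G s (ofLex m)) →
      (∀ m ∈ A, ∀ m', IsEdgeProduct G s (ofLex m') → m < m' → m' ∈ A) →
      RegLE K (symbolicMonomials G (s + 1) ∪ {a | ∃ m ∈ A, ofLex m ≤ a}) (r + 2 * s) →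
      RegLE K (symbolicMonomials G (s + 1)) (r + 2 * s) := by
    intro A
    induction A using Finset.induction_on_min with
    | empty => intro _ _ h; simpa using h
    | insert m A hmA ih =>
      intro hA1 hA2 hreg
      have hm := hA1 m (Finset.mem_insert_self _ _)
      have hA' : ∀ m', IsEdgeProduct G s (ofLex m') → m < m' → m' ∈ A := by
        intro m' hm' hlt
        exact Finset.mem_of_mem_insert_of_ne (hA2 m (Finset.mem_insert_self _ _) m' hm' hlt) hlt.ne'
      refine ih (fun m' h => hA1 m' (Finset.mem_insert_of_mem h)) ?_ ?_
      · intro m' hm' m'' hm'' hlt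
        exact hA' m'' hm'' ((hmA m' hm').trans hlt)
      · have hup : IsUpperSet (symbolicMonomials G (s + 1) ∪ {a | ∃ m' ∈ A, ofLex m' ≤ a}) := by
          refine (isUpperSet_symbolicMonomials G _).union ?_
          rintro a b h ⟨m', hm', h'⟩
          exact ⟨m', hm', h'.trans h⟩
        have hdeg : ((ofLex m).degree : ℤ) = 2 * s := by rw [hm.degree_eq]; push_cast; rfl
        have hcol := setOf_add_mem_symbolicMonomials_union hm
          (fun m' h => ⟨hA1 m' (Finset.mem_insert_of_mem h), hmA m' h⟩) hA'
        rw [← hdeg]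
        refine regLE_of_colon_of_union hup (ofLex m) ?_ ?_
        · obtain ⟨u, v, huv, hmuv⟩ := hm
          have h2r : 2 ≤ r := two_le_of_regLE_edgeMonomials (huv ⟨0, hs⟩) (G.loopless.irrefl _)
            (G.loopless.irrefl _) h1
          rw [hcol]
          have hT : RegLE K {b | b + ofLex m ∈ symbolicMonomials G (s + 1)} r := by
            rw [hmuv, symbolicMonomials_colon huv]
            exact regLE_transversalMonomials (by omega) h1 huv _
          have := RegLEOff.union_variables (by omega : 1 ≤ r)
            (Finset.univ.filter fun w => Finsupp.single w 1 + ofLex m ∈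
              symbolicMonomials G (s + 1) ∪ {a | ∃ m' ∈ A, ofLex m' ≤ a})
            (isUpperSet_colon (isUpperSet_symbolicMonomials G _) _) (hT.off _)
          simpa using this
        · rw [hdeg]
          convert hreg using 1
          ext a
          simp only [Set.mem_union, Set.mem_ofPred_eq, Finset.mem_insert, Set.mem_Ici,
            exists_eq_or_imp, or_assoc]
          rw [or_comm (a := ofLex m ≤ a)]
  have hfin : Set.Finite {m : Lex (V →₀ ℕ) | IsEdgeProduct G s (ofLex m)} := by
    refine (Set.finite_range fun p : (Fin s → V) × (Fin s → V) =>
      toLex (prodVec p.1 + prodVec p.2)).subset ?_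
    rintro m ⟨u, v, _, hm⟩
    exact ⟨(u, v), congrArg toLex hm.symm⟩
  refine key hfin.toFinset (by simp) (fun _ _ m' h _ => by simpa using h) ?_
  convert h2 using 2
  ext a
  simp only [Set.Finite.mem_toFinset, Set.mem_ofPred_eq, powerMonomials]
  exact ⟨fun ⟨m, h, h'⟩ => ⟨ofLex m, h, h'⟩, fun ⟨m, h, h'⟩ => ⟨toLex m, h, h'⟩⟩

end Colon

/-! ## Matchings, covers and odd cycles -/

namespace SimpleGraph

section OddWalks

variable {W : Type*} {H : SimpleGraph W}

lemma Walk.exists_walk_getVert {u v : W} (p : H.Walk u v) {i j : ℕ} (hij : i ≤ j)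
    (hj : j ≤ p.length) : ∃ q : H.Walk (p.getVert i) (p.getVert j), q.length = j - i := by
  induction j, hij using Nat.le_induction with
  | base => exact ⟨Walk.nil, by simp⟩
  | succ j hij ih =>
    obtain ⟨q, hq⟩ := ih (by omega)
    exact ⟨q.concat (p.adj_getVert_succ (by omega)), by rw [Walk.length_concat, hq]; omega⟩

/-- A closed walk of odd length, minimal among all odd closed walks. -/
def Walk.IsShortestOdd {v : W} (w : H.Walk v v) : Prop :=
  Odd w.length ∧ ∀ (u : W) (w' : H.Walk u u), Odd w'.length → w.length ≤ w'.length

lemma exists_isShortestOdd {v : W} (w : H.Walk v v) (hw : Odd w.length) :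
    ∃ (u : W) (w' : H.Walk u u), w'.IsShortestOdd ∧ w'.length ≤ w.length := by
  classical
  have hex : ∃ n, ∃ (u : W) (w' : H.Walk u u), Odd w'.length ∧ w'.length = n :=
    ⟨_, v, w, hw, rfl⟩
  obtain ⟨u, w', h1, h2⟩ := Nat.find_spec hex
  refine ⟨u, w', ⟨h1, fun x w'' h => ?_⟩, ?_⟩
  · rw [h2]; exact Nat.find_min' hex ⟨x, w'', h, rfl⟩
  · rw [h2]; exact Nat.find_min' hex ⟨v, w, hw, rfl⟩

variable {v : W} {w : H.Walk v v}

/-- Two vertices of a closed walk are joined by the walk and by its complementary part. -/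
lemma Walk.exists_complementary_walks (w : H.Walk v v) {i j : ℕ} (hij : i ≤ j)
    (hj : j ≤ w.length) :
    (∃ q : H.Walk (w.getVert i) (w.getVert j), q.length = j - i) ∧
    (∃ q : H.Walk (w.getVert j) (w.getVert i), q.length = w.length - (j - i)) := by
  refine ⟨w.exists_walk_getVert hij hj, ?_⟩
  obtain ⟨q1, h1⟩ := w.exists_walk_getVert hj le_rfl
  obtain ⟨q2, h2⟩ := w.exists_walk_getVert (Nat.zero_le i) (hij.trans hj)
  have e : w.getVert w.length = w.getVert 0 := by simp
  refine ⟨(q1.copy rfl e).append q2, ?_⟩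
  rw [Walk.length_append, Walk.length_copy, h1, h2]
  omega

/-- A repeated vertex would split the walk into two shorter closed walks, one of them odd. -/
lemma Walk.IsShortestOdd.getVert_ne (hw : w.IsShortestOdd) {i j : ℕ} (hij : i < j)
    (hj : j < w.length) : w.getVert i ≠ w.getVert j := by
  intro he
  obtain ⟨⟨q1, h1⟩, q2, h2⟩ := w.exists_complementary_walks hij.le hj.le
  rcases Nat.even_or_odd (j - i) with h | h
  · have := hw.2 _ (q2.copy rfl he) (by
      rw [Walk.length_copy, h2]
      exact Nat.Odd.sub_even (by omega) hw.1 h)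
    rw [Walk.length_copy, h2] at this
    omega
  · have := hw.2 _ (q1.copy rfl he.symm) (by rw [Walk.length_copy, h1]; exact h)
    rw [Walk.length_copy, h1] at this
    omega

/-- There are no chords: an edge between two vertices closes up the even one of the two arcs to an
odd walk, which must be as long as the whole. -/
lemma Walk.IsShortestOdd.eq_of_adj (hw : w.IsShortestOdd) {i j : ℕ} (hij : i < j)
    (hj : j < w.length) (hadj : H.Adj (w.getVert i) (w.getVert j)) :
    j = i + 1 ∨ (i = 0 ∧ j + 1 = w.length) := by
  obtain ⟨⟨q1, h1⟩, q2, h2⟩ := w.exists_complementary_walks hij.le hj.le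
  rcases Nat.even_or_odd (j - i) with h | h
  · have := hw.2 _ (Walk.cons hadj.symm q1) (by
      rw [Walk.length_cons, h1]; exact h.add_one)
    rw [Walk.length_cons, h1] at this
    right; omega
  · have := hw.2 _ (Walk.cons hadj q2) (by
      rw [Walk.length_cons, h2]
      exact (Nat.Odd.sub_odd hw.1 h).add_one)
    rw [Walk.length_cons, h2] at this
    left; omega

lemma Walk.IsShortestOdd.three_le (hw : w.IsShortestOdd) : 3 ≤ w.length := by
  obtain ⟨k, hk⟩ := hw.1
  by_contra hlt
  have h1 : w.length = 1 := by omega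
  have := w.adj_getVert_succ (i := 0) (by omega)
  have e : w.getVert (0 + 1) = w.getVert 0 := by
    rw [zero_add, ← h1]; simp
  rw [e] at this
  exact H.loopless.irrefl _ this

lemma Walk.IsShortestOdd.isCycle (hw : w.IsShortestOdd) : w.IsCycle := by
  have h3 := hw.three_le
  cases w with
  | nil => simp at h3
  | @cons _ y _ h p =>
    have hp : p.IsPath := by
      rw [← Walk.IsPath.getVert_injOn_iff]
      intro i hi j hj he
      simp only [Set.mem_ofPred_eq] at hi hj
      rw [← Walk.getVert_cons_succ p h, ← Walk.getVert_cons_succ p h] at he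
      have hlen : (Walk.cons h p).length = p.length + 1 := Walk.length_cons _ _
      have hend : (Walk.cons h p).getVert (p.length + 1) = (Walk.cons h p).getVert 0 := by
        rw [← hlen]; simp
      have key : ∀ i j, i < j → j ≤ p.length →
          (Walk.cons h p).getVert (i + 1) ≠ (Walk.cons h p).getVert (j + 1) := by
        intro i j hij hj he
        by_cases hjl : j = p.length
        · rw [hjl, hend] at he
          exact hw.getVert_ne (i := 0) (j := i + 1) (by omega) (by omega) he.symm
        · exact hw.getVert_ne (by omega) (by omega) he
      rcases lt_trichotomy i j with h' | h' | h'
      · exact absurd he (key i j h' hj)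
      · exact h'
      · exact absurd he.symm (key j i h' hi)
    rw [Walk.cons_isCycle_iff]
    refine ⟨hp, fun he => ?_⟩
    rw [Sym2.eq_swap] at he
    have := hp.length_eq_one_of_mem_edges he
    rw [Walk.length_cons] at h3
    omega

lemma exists_isCycle_odd_length_le {v : W} (w : H.Walk v v) (hw : Odd w.length) :
    ∃ (u : W) (c : H.Walk u u), c.IsCycle ∧ Odd c.length ∧ c.length ≤ w.length := by
  obtain ⟨u, c, hc, hle⟩ := exists_isShortestOdd w hw
  exact ⟨u, c, hc.isCycle, hc.1, hle⟩

end OddWalks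

section Matchings

variable {W : Type*} (H : SimpleGraph W)

/-- `H` has a matching with `s` edges. -/
def HasMatching (s : ℕ) : Prop :=
  ∃ p q : Fin s → W, (∀ i, H.Adj (p i) (q i)) ∧ Function.Injective p ∧ Function.Injective q ∧
    ∀ i j, p i ≠ q j

variable {H}

/-- **König's theorem**: in a bipartite graph there is a matching as large as a minimum cover. -/
lemma Colorable.hasMatching [Finite W] (hc : H.Colorable 2) {t : ℕ}
    (ht : ∀ T : Finset W, H.IsVertexCover T → t ≤ T.card) : H.HasMatching t := by
  classical
  cases nonempty_fintype W
  obtain ⟨col⟩ := hc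
  obtain ⟨T, hT, hmin⟩ := Finset.exists_min_image
    (Finset.univ.filter fun T : Finset W => H.IsVertexCover T) Finset.card
    ⟨Finset.univ, by simp⟩
  simp only [Finset.mem_filter, Finset.mem_univ, true_and] at hT hmin
  have hall : ∀ b : Fin 2, ∃ f : {x // x ∈ T ∧ col x = b} → W, Function.Injective f ∧
      ∀ x : {x // x ∈ T ∧ col x = b}, f x ∈ Finset.univ.filter fun y => y ∉ T ∧ H.Adj x y := by
    intro b
    rw [← Finset.all_card_le_biUnion_card_iff_exists_injective]
    intro S
    set S' : Finset W := S.map (Function.Embedding.subtype _) with hS'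
    set N : Finset W := S.biUnion fun x => Finset.univ.filter fun y => y ∉ T ∧ H.Adj x y with hN
    have hS'T : S' ⊆ T := by
      intro x hx
      obtain ⟨y, _, rfl⟩ := Finset.mem_map.1 hx
      exact y.2.1
    -- Hall's condition: trading `S'` for its neighbours outside `T` keeps a cover, because vertices
    -- of `S'` share a colour and are pairwise nonadjacent. Minimality of `T` gives `|S| ≤ |N|`.
    have hcov : H.IsVertexCover ((T \ S' ∪ N : Finset W) : Set W) := by
      have key : ∀ x y, H.Adj x y → x ∈ T → x ∈ T \ S' ∪ N ∨ y ∈ T \ S' ∪ N := by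
        intro x y hxy hx
        by_cases hxS : x ∈ S'
        · right
          obtain ⟨z, hz, rfl⟩ := Finset.mem_map.1 hxS
          by_cases hy : y ∈ T
          · refine Finset.mem_union_left _ (Finset.mem_sdiff.2 ⟨hy, fun hyS => ?_⟩)
            obtain ⟨z', _, rfl⟩ := Finset.mem_map.1 hyS
            exact col.valid hxy (z.2.2.trans z'.2.2.symm)
          · exact Finset.mem_union_right _ (Finset.mem_biUnion.2 ⟨z, hz, by simp; exact ⟨hy, hxy⟩⟩)
        · exact Or.inl (Finset.mem_union_left _ (Finset.mem_sdiff.2 ⟨hx, hxS⟩))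
      intro x y hxy
      rcases hT hxy with h | h
      · exact_mod_cast key x y hxy (by simpa using h)
      · exact_mod_cast (key y x hxy.symm (by simpa using h)).symm
    have h1 := hmin _ hcov
    have h2 := Finset.card_union_le (T \ S') N
    have h3 := Finset.card_sdiff_add_card_eq_card hS'T
    have h4 : S'.card = S.card := Finset.card_map _
    omega
  choose f hf hf' using hall
  simp only [Finset.mem_filter, Finset.mem_univ, true_and] at hf'
  have hcard : Fintype.card (Fin t) ≤ Fintype.card T := by simpa using ht T hT
  obtain ⟨e⟩ := Function.Embedding.nonempty_of_card_le hcard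
  set g : T → W := fun x => f (col x) ⟨x, x.2, rfl⟩ with hg
  have hg' : ∀ x, g x ∉ T ∧ H.Adj x (g x) := fun x => hf' (col x) ⟨x, x.2, rfl⟩
  have hginj : Function.Injective g := by
    intro x y hxy
    by_cases h : col (x : W) = col (y : W)
    · have key : ∀ b (hb : col (x : W) = b) (hb' : col (y : W) = b),
          f b ⟨x, x.2, hb⟩ = f b ⟨y, y.2, hb'⟩ := by
        rintro b rfl hb'
        have : g y = f (col (x : W)) ⟨y, y.2, hb'⟩ := by
          have aux : ∀ b b' (e : b = b') (h1 : col (y : W) = b) (h2 : col (y : W) = b'),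
              f b ⟨y, y.2, h1⟩ = f b' ⟨y, y.2, h2⟩ := by
            rintro b b' rfl _ _; rfl
          exact aux _ _ h.symm rfl hb'
        rw [← this, ← hxy]
      have := hf _ (key _ rfl h.symm)
      exact Subtype.ext (Subtype.mk.inj this)
    · have h1 := col.valid (hg' x).2
      have h2 := col.valid (hg' y).2
      rw [hxy] at h1
      exfalso
      -- Partners of differently coloured vertices cannot coincide, as a third colour would be
      -- needed.
      revert h1 h2 h
      generalize col (x : W) = a
      generalize col (y : W) = b
      generalize col (g y) = c
      revert a b c
      decide
  refine ⟨fun i => e i, fun i => g (e i), fun i => (hg' _).2,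
    Subtype.val_injective.comp e.injective, hginj.comp e.injective, fun i j h => ?_⟩
  exact (hg' (e j)).1 ((show (e i : W) = g (e j) from h) ▸ (e i).2)

lemma HasMatching.cons {k : ℕ} {p q : Fin k → W} (hadj : ∀ i, H.Adj (p i) (q i))
    (hp : Function.Injective p) (hq : Function.Injective q) (hpq : ∀ i j, p i ≠ q j) {x y : W}
    (hxy : H.Adj x y) (hx : ∀ i, p i ≠ x ∧ q i ≠ x) (hy : ∀ i, p i ≠ y ∧ q i ≠ y) :
    H.HasMatching (k + 1) := by
  refine ⟨Fin.cons x p, Fin.cons y q, ?_, ?_, ?_, ?_⟩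
  · intro i
    refine Fin.cases ?_ (fun i => ?_) i
    · simpa using hxy
    · simpa using hadj i
  · rw [Fin.cons_injective_iff]
    exact ⟨fun ⟨i, hi⟩ => (hx i).1 hi, hp⟩
  · rw [Fin.cons_injective_iff]
    exact ⟨fun ⟨i, hi⟩ => (hy i).2 hi, hq⟩
  · intro i j
    refine Fin.cases ?_ (fun i => ?_) i
    · refine Fin.cases ?_ (fun j => ?_) j
      · simpa using hxy.ne
      · simpa using (hx j).2.symm
    · refine Fin.cases ?_ (fun j => ?_) j
      · simpa using (hy i).1
      · simpa using hpq i j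

/-- Cyclically consecutive vertices of a shortest odd closed walk are adjacent. -/
lemma Walk.IsShortestOdd.adj_mod {v : W} {w : H.Walk v v} (hw : w.IsShortestOdd) (k : ℕ) :
    H.Adj (w.getVert (k % w.length)) (w.getVert ((k + 1) % w.length)) := by
  have h3 := hw.three_le
  have hlt := Nat.mod_lt k (by omega : w.length > 0)
  have hadj := w.adj_getVert_succ hlt
  by_cases h : k % w.length + 1 < w.length
  · have e : (k + 1) % w.length = k % w.length + 1 := by
      rw [Nat.add_mod, Nat.mod_eq_of_lt (by omega : 1 < w.length), Nat.mod_eq_of_lt h]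
    rwa [e]
  · have e1 : k % w.length + 1 = w.length := by omega
    have e : (k + 1) % w.length = 0 := by
      rw [Nat.add_mod, Nat.mod_eq_of_lt (by omega : 1 < w.length), e1, Nat.mod_self]
    rw [e]
    rw [e1] at hadj
    simpa using hadj

lemma Walk.IsShortestOdd.mod_injOn {v : W} {w : H.Walk v v} (hw : w.IsShortestOdd) (r : ℕ)
    {i j : ℕ} (hi : i < w.length) (hj : j < w.length)
    (h : w.getVert ((r + i) % w.length) = w.getVert ((r + j) % w.length)) : i = j := by
  have h3 := hw.three_le
  have hpos : 0 < w.length := by omega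
  have h1 : (r + i) % w.length = (r + j) % w.length := by
    rcases lt_trichotomy ((r + i) % w.length) ((r + j) % w.length) with h' | h' | h'
    · exact absurd h (hw.getVert_ne h' (Nat.mod_lt _ hpos))
    · exact h'
    · exact absurd h.symm (hw.getVert_ne h' (Nat.mod_lt _ hpos))
  have h2 : i ≡ j [MOD w.length] := Nat.ModEq.add_left_cancel' r h1
  exact Nat.ModEq.eq_of_lt_of_lt h2 hi hj

/-- A graph without short odd closed walks and with cover number greater than `s` has a matching
with `s` edges. -/
theorem hasMatching_of_odd_walks [Finite W] {s : ℕ}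
    (hodd : ∀ (v : W) (w : H.Walk v v), Odd w.length → 2 * s ≤ w.length + 1)
    (hcov : ∀ T : Finset W, H.IsVertexCover T → s + 1 ≤ T.card) : H.HasMatching s := by
  classical
  cases nonempty_fintype W
  by_cases hbip : H.Colorable 2
  · exact hbip.hasMatching fun T hT => (hcov T hT).trans' (Nat.le_succ s)
  rw [two_colorable_iff_forall_loop_even] at hbip
  push Not at hbip
  obtain ⟨v0, w0, hw0⟩ := hbip
  obtain ⟨v, w, hw, -⟩ := exists_isShortestOdd w0 (by simpa using hw0)
  have h3 := hw.three_le
  have hlen := hodd v w hw.1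
  obtain ⟨n, hn⟩ := hw.1
  have hpart : ∀ (k r : ℕ), 2 * k + r ≤ w.length → ∀ o : ℕ, ∃ p q : Fin k → W,
      (∀ i, H.Adj (p i) (q i)) ∧ Function.Injective p ∧ Function.Injective q ∧
      (∀ i j, p i ≠ q j) ∧ ∀ i, (∃ l, r ≤ l ∧ l < w.length ∧
        p i = w.getVert ((o + l) % w.length)) ∧ (∃ l, r ≤ l ∧ l < w.length ∧
        q i = w.getVert ((o + l) % w.length)) := by
    intro k r hk o
    refine ⟨fun i => w.getVert ((o + (r + 2 * i)) % w.length),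
      fun i => w.getVert ((o + (r + 2 * i + 1)) % w.length), fun i => ?_, fun i j h => ?_,
      fun i j h => ?_, fun i j h => ?_, fun i => ⟨⟨r + 2 * i, ?_, ?_, rfl⟩,
        ⟨r + 2 * i + 1, ?_, ?_, rfl⟩⟩⟩
    · have := hw.adj_mod (o + (r + 2 * i))
      rwa [add_assoc o] at this
    · have := hw.mod_injOn o (by omega) (by omega) h
      omega
    · have := hw.mod_injOn o (by omega) (by omega) h
      omega
    · have := hw.mod_injOn o (by omega) (by omega) h
      omega
    all_goals omega
  by_cases hs : 2 * s ≤ w.length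
  · obtain ⟨p, q, h1, h2, h4, h5, -⟩ := hpart s 0 (by omega) 0
    exact ⟨p, q, h1, h2, h4, h5⟩
  have hs1 : s = n + 1 := by omega
  subst hs1
  -- The cycle now has length `2s - 1`. Its `s` vertices in even positions are too few to cover, so
  -- some edge `xy` avoids them.
  have hT : ¬ H.IsVertexCover
      (((Finset.range (n + 1)).image fun l => w.getVert (2 * l) : Finset W) : Set W) := by
    intro h
    have h1 := hcov _ h
    have h2 := Finset.card_image_le (s := Finset.range (n + 1)) (f := fun l => w.getVert (2 * l))
    rw [Finset.card_range] at h2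
    omega
  unfold IsVertexCover at hT
  push Not at hT
  obtain ⟨x, y, hxy, hx, hy⟩ := hT
  have hoddpos : ∀ z, z ∉ (((Finset.range (n + 1)).image fun l => w.getVert (2 * l) : Finset W) :
      Set W) → ∀ i < w.length, z = w.getVert i → Odd i := by
    intro z hz i hi hzi
    by_contra hev
    obtain ⟨l, hl⟩ := (Nat.not_odd_iff_even.1 hev)
    refine hz ?_
    simp only [Finset.coe_image, Set.mem_image, Finset.mem_coe, Finset.mem_range]
    exact ⟨l, by omega, by rw [hzi, hl, two_mul]⟩
  -- Two odd positions are never cyclically adjacent, and the cycle has no chords; hence `x` or `y`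
  -- lies off the cycle.
  have hnot : ∀ i < w.length, ∀ j < w.length, ¬ (x = w.getVert i ∧ y = w.getVert j) := by
    rintro i hi j hj ⟨hxi, hyj⟩
    have hio := hoddpos x hx i hi hxi
    have hjo := hoddpos y hy j hj hyj
    rw [hxi, hyj] at hxy
    obtain ⟨a, ha⟩ := hio
    obtain ⟨b, hb⟩ := hjo
    rcases lt_trichotomy i j with h | h | h
    · rcases hw.eq_of_adj h hj hxy with h' | h' <;> omega
    · subst h; exact H.loopless.irrefl _ hxy
    · rcases hw.eq_of_adj h hi hxy.symm with h' | h' <;> omega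
  -- Start the cycle at `x` if `x` lies on it, anywhere otherwise, and skip the starting vertex: the
  -- other `2n` vertices carry `n` disjoint edges, to which `xy` is added.
  have hfin : ∀ x y, H.Adj x y → (∀ i < w.length, y ≠ w.getVert i) → H.HasMatching (n + 1) := by
    intro x y hxy hy
    have hpos : 0 < w.length := by omega
    obtain ⟨o, ho⟩ : ∃ o, ∀ l, 1 ≤ l → l < w.length → w.getVert ((o + l) % w.length) ≠ x := by
      by_cases hxw : ∃ i < w.length, x = w.getVert i
      · obtain ⟨i, hi, rfl⟩ := hxw
        refine ⟨i, fun l hl hl' he => ?_⟩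
        have := hw.mod_injOn i (j := 0) hl' hpos (by
          rw [he, add_zero, Nat.mod_eq_of_lt hi])
        omega
      · exact ⟨0, fun l _ _ he => hxw ⟨_, Nat.mod_lt _ hpos, he.symm⟩⟩
    obtain ⟨p, q, h1, h2, h4, h5, h6⟩ := hpart n 1 (by omega) o
    refine HasMatching.cons h1 h2 h4 h5 hxy (fun i => ?_) (fun i => ?_)
    · obtain ⟨⟨l, hl, hl', e⟩, l', hm, hm', e'⟩ := h6 i
      exact ⟨e ▸ ho l hl hl', e' ▸ ho l' hm hm'⟩
    · obtain ⟨⟨l, hl, hl', e⟩, l', hm, hm', e'⟩ := h6 i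
      exact ⟨e ▸ (hy _ (Nat.mod_lt _ hpos)).symm, e' ▸ (hy _ (Nat.mod_lt _ hpos)).symm⟩
  by_cases hyw : ∀ i < w.length, y ≠ w.getVert i
  · exact hfin x y hxy hyw
  · push Not at hyw
    obtain ⟨j, hj, hyj⟩ := hyw
    exact hfin y x hxy.symm fun i hi hxi => hnot i hi j hj ⟨hxi, hyj⟩

end Matchings

end SimpleGraph

/-! ### Containment of the symbolic power in the ordinary power. -/

section SymbolicInPower

variable {V : Type*} [Fintype V] {G : SimpleGraph V} {s : ℕ}

theorem symbolicMonomials_subset_powerMonomials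
    (hG : ∀ (v : V) (c : G.Walk v v), c.IsCycle → Odd c.length → 2 * s ≤ c.length + 1) :
    symbolicMonomials G (s + 1) ⊆ powerMonomials G s := by
  classical
  intro a ha
  -- Each vertex `x` is replaced by `a x` independent copies, so a matching with `s` edges projects
  -- to a product of `s` edges dividing `x^a`.
  set H : SimpleGraph (Σ x : V, Fin (a x)) := G.comap Sigma.fst with hH
  obtain ⟨p, q, hadj, hp, hq, hpq⟩ : H.HasMatching s := by
    refine SimpleGraph.hasMatching_of_odd_walks ?_ ?_
    · intro v w hw
      let φ : H →g G := ⟨Sigma.fst, fun h => h⟩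
      obtain ⟨u, c, hc, hodd, hle⟩ := SimpleGraph.exists_isCycle_odd_length_le (w.map φ)
        (by rwa [SimpleGraph.Walk.length_map])
      rw [SimpleGraph.Walk.length_map] at hle
      have := hG u c hc hodd
      omega
    · intro T hT
      -- The vertices with all copies in `T` form a cover of `G`: an edge with neither end in `C`
      -- would lift to an edge missed by `T`.
      set C : Finset V := Finset.univ.filter fun x => ∀ i, (⟨x, i⟩ : Σ x : V, Fin (a x)) ∈ T
        with hC
      have hCc : G.IsVertexCover (C : Set V) := by
        intro x y hxy
        by_contra! hcon
        simp only [hC, Finset.coe_filter, Finset.mem_univ, true_and, Set.mem_ofPred_eq,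
          not_forall] at hcon
        obtain ⟨⟨i, hi⟩, j, hj⟩ := hcon
        have : H.Adj ⟨x, i⟩ ⟨y, j⟩ := hxy
        rcases hT this with h | h
        · exact hi (by simpa using h)
        · exact hj (by simpa using h)
      refine (ha C hCc).trans ?_
      have hsub : C.sigma (fun x => (Finset.univ : Finset (Fin (a x)))) ⊆ T := by
        rintro ⟨x, i⟩ hx
        simp only [Finset.mem_sigma, Finset.mem_univ, and_true, hC, Finset.mem_filter,
          true_and] at hx
        exact hx i
      have := Finset.card_le_card hsub
      rwa [Finset.card_sigma, Finset.sum_congr rfl (fun x _ => by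
        rw [Finset.card_univ, Fintype.card_fin])] at this
  refine ⟨prodVec (fun i => (p i).1) + prodVec (fun i => (q i).1),
    ⟨fun i => (p i).1, fun i => (q i).1, hadj, rfl⟩, fun x => ?_⟩
  rw [Finsupp.add_apply, prodVec_apply, prodVec_apply]
  have h1 : ((Finset.univ.filter fun l => (p l).1 = x).image p ∪
      (Finset.univ.filter fun l => (q l).1 = x).image q) ⊆
      (Finset.univ : Finset (Fin (a x))).image (fun i => (⟨x, i⟩ : Σ x : V, Fin (a x))) := by
    intro z hz
    have hz' : z.1 = x := by
      simp only [Finset.mem_union, Finset.mem_image, Finset.mem_filter, Finset.mem_univ,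
        true_and] at hz
      rcases hz with ⟨l, hl, rfl⟩ | ⟨l, hl, rfl⟩ <;> exact hl
    subst hz'
    exact Finset.mem_image.2 ⟨z.2, Finset.mem_univ _, rfl⟩
  have h2 := Finset.card_le_card h1
  rw [Finset.card_union_of_disjoint, Finset.card_image_of_injective _ hp,
    Finset.card_image_of_injective _ hq] at h2
  · refine h2.trans (Finset.card_image_le.trans ?_)
    simp
  · rw [Finset.disjoint_left]
    intro z hz hz'
    simp only [Finset.mem_image] at hz hz'
    obtain ⟨l, _, rfl⟩ := hz
    obtain ⟨l', _, h⟩ := hz'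
    exact hpq l l' h.symm

end SymbolicInPower

/-! ## Graded Koszul homology of submodules of free modules -/

section HomogeneousVectors

variable {V K : Type*} [Field K] {ι : Type*} {deg : ι → ℤ} {j : ℤ}

lemma isHomogeneousVector_zero : IsHomogeneousVector deg (0 : ι → MvPolynomial V K) j := by
  intro c m hm
  simp at hm

lemma IsHomogeneousVector.add {f g : ι → MvPolynomial V K} (hf : IsHomogeneousVector deg f j)
    (hg : IsHomogeneousVector deg g j) : IsHomogeneousVector deg (f + g) j := by
  classical
  intro c m hm
  rcases Finset.mem_union.1 (support_add hm) with h | h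
  · exact hf c m h
  · exact hg c m h

lemma IsHomogeneousVector.neg {f : ι → MvPolynomial V K} (hf : IsHomogeneousVector deg f j) :
    IsHomogeneousVector deg (-f) j := by
  intro c m hm
  rw [Pi.neg_apply, support_neg] at hm
  exact hf c m hm

lemma IsHomogeneousVector.zsmul {f : ι → MvPolynomial V K} (hf : IsHomogeneousVector deg f j)
    (n : ℤ) : IsHomogeneousVector deg (n • f) j := by
  intro c m hm
  refine hf c m ?_
  rw [mem_support_iff] at hm ⊢
  intro h0
  refine hm ?_
  rw [Pi.smul_apply, ← Int.cast_smul_eq_zsmul K, coeff_smul, h0, smul_zero]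

lemma IsHomogeneousVector.sum {α : Type*} {s : Finset α} {f : α → ι → MvPolynomial V K}
    (hf : ∀ x ∈ s, IsHomogeneousVector deg (f x) j) :
    IsHomogeneousVector deg (∑ x ∈ s, f x) j := by
  classical
  induction s using Finset.induction_on with
  | empty => simpa using isHomogeneousVector_zero
  | insert x s hx ih =>
    rw [Finset.sum_insert hx]
    exact (hf x (Finset.mem_insert_self _ _)).add
      (ih fun y hy => hf y (Finset.mem_insert_of_mem hy))

lemma IsHomogeneousVector.monomial_smul {f : ι → MvPolynomial V K}
    (hf : IsHomogeneousVector deg f j) (m : V →₀ ℕ) (r : K) :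
    IsHomogeneousVector deg (monomial m r • f) (m.degree + j) := by
  intro c n hn
  rw [Pi.smul_apply, smul_eq_mul, mem_support_iff, coeff_monomial_mul'] at hn
  split_ifs at hn with h
  · obtain ⟨n', rfl⟩ := exists_add_of_le h
    have h1 : coeff n' (f c) ≠ 0 := by
      intro h0; simp [h0] at hn
    have := hf c n' (mem_support_iff.2 h1)
    rw [map_add]; push_cast; omega
  · exact absurd rfl hn

lemma IsHomogeneousVector.X_smul {f : ι → MvPolynomial V K}
    (hf : IsHomogeneousVector deg f j) (x : V) :
    IsHomogeneousVector deg ((X x : MvPolynomial V K) • f) (j + 1) := by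
  have := hf.monomial_smul (Finsupp.single x 1) (1 : K)
  rwa [Finsupp.degree_single, Nat.cast_one, add_comm] at this

/-- The homogeneous component of degree `j` of an element of the graded free module
`⨁ b, S(-deg b)`. -/
def homPart (deg : ι → ℤ) (j : ℤ) (f : ι → MvPolynomial V K) : ι → MvPolynomial V K :=
  fun b => ∑ m ∈ (f b).support.filter fun m => (m.degree : ℤ) + deg b = j,
    monomial m (coeff m (f b))

open Classical in
lemma coeff_homPart (f : ι → MvPolynomial V K) (b : ι) (m : V →₀ ℕ) :
    coeff m (homPart deg j f b) = if (m.degree : ℤ) + deg b = j then coeff m (f b) else 0 := by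
  unfold homPart
  rw [coeff_sum]
  simp only [coeff_monomial]
  rw [Finset.sum_ite_eq']
  simp only [Finset.mem_filter, mem_support_iff]
  by_cases h : (m.degree : ℤ) + deg b = j
  · simp only [h, and_true, if_true]
    split_ifs with h1
    · rfl
    · push Not at h1; exact h1.symm
  · simp [h]

lemma isHomogeneousVector_homPart (f : ι → MvPolynomial V K) :
    IsHomogeneousVector deg (homPart deg j f) j := by
  intro b m hm
  rw [mem_support_iff, coeff_homPart] at hm
  by_contra h
  rw [if_neg h] at hm
  exact hm rfl

lemma IsHomogeneousVector.homPart_eq {f : ι → MvPolynomial V K}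
    (hf : IsHomogeneousVector deg f j) : homPart deg j f = f := by
  ext b m
  rw [coeff_homPart]
  split_ifs with h
  · rfl
  · by_contra h0
    exact h (hf b m (mem_support_iff.2 (Ne.symm h0)))

lemma IsHomogeneousVector.homPart_eq_zero {f : ι → MvPolynomial V K} {i : ℤ}
    (hf : IsHomogeneousVector deg f i) (hij : i ≠ j) : homPart deg j f = 0 := by
  ext b m
  rw [coeff_homPart]
  split_ifs with h
  · by_contra h0
    exact hij ((hf b m (mem_support_iff.2 (by simpa using h0))).symm.trans h)
  · simp

lemma homPart_add (f g : ι → MvPolynomial V K) :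
    homPart deg j (f + g) = homPart deg j f + homPart deg j g := by
  ext b m
  rw [Pi.add_apply, coeff_add, coeff_homPart, coeff_homPart, coeff_homPart, Pi.add_apply, coeff_add]
  split_ifs <;> simp

lemma homPart_zero : homPart deg j (0 : ι → MvPolynomial V K) = 0 :=
  isHomogeneousVector_zero.homPart_eq

/-- `φ` preserves the degrees. -/
def IsHomogeneousMap {ι κ : Type*} [DecidableEq ι] (deg : ι → ℤ) (deg' : κ → ℤ)
    (φ : (ι → MvPolynomial V K) →ₗ[MvPolynomial V K] (κ → MvPolynomial V K)) : Prop :=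
  ∀ b, IsHomogeneousVector deg' (φ (Pi.single b 1)) (deg b)

variable {κ : Type*} [DecidableEq ι] [Fintype ι] {deg' : κ → ℤ}
  {φ : (ι → MvPolynomial V K) →ₗ[MvPolynomial V K] (κ → MvPolynomial V K)}

lemma isHomogeneousVector_single_monomial (b : ι) (m : V →₀ ℕ) (r : K) :
    IsHomogeneousVector deg (Pi.single b (monomial m r) : ι → MvPolynomial V K)
      (m.degree + deg b) := by
  intro c n hn
  by_cases hc : c = b
  · subst hc
    rw [Pi.single_eq_same] at hn
    have := support_monomial_subset hn
    rw [Finset.mem_singleton] at this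
    rw [this]
  · rw [Pi.single_eq_of_ne hc] at hn
    simp at hn

lemma IsHomogeneousMap.map_single_monomial (hφ : IsHomogeneousMap deg deg' φ) (b : ι)
    (m : V →₀ ℕ) (r : K) :
    IsHomogeneousVector deg' (φ (Pi.single b (monomial m r))) (m.degree + deg b) := by
  have : (Pi.single b (monomial m r) : ι → MvPolynomial V K) =
      monomial m r • Pi.single b 1 := by
    rw [← Pi.single_smul, smul_eq_mul, mul_one]
  rw [this, map_smul]
  exact (hφ b).monomial_smul m r

lemma IsHomogeneousMap.map_homPart (hφ : IsHomogeneousMap deg deg' φ)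
    (f : ι → MvPolynomial V K) : φ (homPart deg j f) = homPart deg' j (φ f) := by
  have hadd : ∀ f g : ι → MvPolynomial V K, φ (homPart deg j f) = homPart deg' j (φ f) →
      φ (homPart deg j g) = homPart deg' j (φ g) →
      φ (homPart deg j (f + g)) = homPart deg' j (φ (f + g)) := by
    intro f g hf hg
    rw [homPart_add, map_add, map_add, homPart_add, hf, hg]
  have hsingle : ∀ (b : ι) (g : MvPolynomial V K),
      φ (homPart deg j (Pi.single b g)) = homPart deg' j (φ (Pi.single b g)) := by
    intro b g
    induction g using MvPolynomial.induction_on' with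
    | monomial m r =>
      have h1 := isHomogeneousVector_single_monomial (deg := deg) b m r
      have h2 := hφ.map_single_monomial b m r
      by_cases h : (m.degree : ℤ) + deg b = j
      · rw [h] at h1 h2
        rw [h1.homPart_eq, h2.homPart_eq]
      · rw [h1.homPart_eq_zero h, h2.homPart_eq_zero h, map_zero]
    | add p q hp hq =>
      rw [Pi.single_add]
      exact hadd _ _ hp hq
  rw [← Finset.univ_sum_single f]
  induction (Finset.univ : Finset ι) using Finset.induction_on with
  | empty => simp [homPart_zero]
  | insert b s hb ih =>
    rw [Finset.sum_insert hb]
    exact hadd _ _ (hsingle _ _) ih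

end HomogeneousVectors

section KoszulExact

variable {V : Type*} [LinearOrder V] [Fintype V] {K : Type*} [Field K] {ι : Type*} [Fintype ι]

variable (K) in
/-- The Koszul differential with respect to the variables. -/
abbrev koszulX {N : Type*} [AddCommGroup N] [Module (MvPolynomial V K) N] :
    (Finset V → N) →ₗ[MvPolynomial V K] (Finset V → N) :=
  koszulD fun v => (X v : MvPolynomial V K)

/-- `c` is a Koszul chain of `M` of homological degree `p` and internal degree `j`. -/
structure IsKoszulChain (deg : ι → ℤ) (M : Submodule (MvPolynomial V K) (ι → MvPolynomial V K))
    (p : ℕ) (j : ℤ) (c : Finset V → ι → MvPolynomial V K) : Prop where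
  mem : ∀ τ, c τ ∈ M
  card : ∀ τ, c τ ≠ 0 → τ.card = p
  hom : ∀ τ, IsHomogeneousVector deg (c τ) (j - p)

/-- The Koszul homology of `M` vanishes in homological degree `p` and internal degree `j`. -/
def KoszulExactAt (deg : ι → ℤ) (M : Submodule (MvPolynomial V K) (ι → MvPolynomial V K))
    (p : ℕ) (j : ℤ) : Prop :=
  ∀ c, IsKoszulChain deg M p j c → koszulX K c = 0 →
    ∃ c', IsKoszulChain deg M (p + 1) j c' ∧ koszulX K c' = c

variable {deg : ι → ℤ} {M M' : Submodule (MvPolynomial V K) (ι → MvPolynomial V K)} {p : ℕ} {j : ℤ}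
  {c c' : Finset V → ι → MvPolynomial V K}

lemma IsKoszulChain.of_mem (hc : IsKoszulChain deg M p j c) (h : ∀ τ, c τ ∈ M') :
    IsKoszulChain deg M' p j c := ⟨h, hc.card, hc.hom⟩

lemma IsKoszulChain.sub (hc : IsKoszulChain deg M p j c) (hc' : IsKoszulChain deg M p j c') :
    IsKoszulChain deg M p j (c - c') where
  mem τ := M.sub_mem (hc.mem τ) (hc'.mem τ)
  card τ h := by
    by_cases h0 : c τ = 0
    · exact hc'.card τ (by simpa [h0] using h)
    · exact hc.card τ h0
  hom τ := by
    rw [Pi.sub_apply, sub_eq_add_neg]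
    exact (hc.hom τ).add (hc'.hom τ).neg

lemma IsKoszulChain.koszulX (hc : IsKoszulChain deg M (p + 1) j c) :
    IsKoszulChain deg M p j (koszulX K c) where
  mem τ := by
    rw [koszulD_apply]
    exact M.sum_mem fun x _ => M.toAddSubgroup.zsmul_mem (M.smul_mem _ (hc.mem _)) _
  card τ h := by
    rw [koszulD_apply] at h
    obtain ⟨x, hx, hne⟩ := Finset.exists_ne_zero_of_sum_ne_zero h
    have := hc.card (insert x τ) (fun h0 => hne (by rw [h0, smul_zero, smul_zero]))
    rw [Finset.card_insert_of_notMem (by simpa using hx)] at this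
    omega
  hom τ := by
    rw [koszulD_apply]
    refine IsHomogeneousVector.sum fun x _ => IsHomogeneousVector.zsmul ?_ _
    have := (hc.hom (insert x τ)).X_smul x
    convert this using 1
    push_cast; ring

lemma IsKoszulChain.koszulX_eq_zero (hc : IsKoszulChain deg M 0 j c) : _root_.koszulX K c = 0 := by
  funext τ
  rw [koszulD_apply]
  refine Finset.sum_eq_zero fun x _ => ?_
  have : c (insert x τ) = 0 := by
    by_contra h0
    have := hc.card _ h0
    simp at this
  rw [this, smul_zero, smul_zero]

open Classical in
/-- The simplicial chain formed by the coefficients of `c` in the multidegree `a` and the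
coordinate `b`. -/
def multidegreePart (a : V →₀ ℕ) (b : ι) (c : Finset V → ι → MvPolynomial V K) : Finset V → K :=
  fun τ => if indVec τ ≤ a then coeff (a - indVec τ) (c τ b) else 0

lemma multidegreePart_add_indVec (m : V →₀ ℕ) (b : ι) (τ : Finset V) :
    multidegreePart (m + indVec τ) b c τ = coeff m (c τ b) := by
  unfold multidegreePart
  rw [if_pos le_add_self, add_tsub_cancel_right]

lemma indVec_insert {x : V} {τ : Finset V} (hx : x ∉ τ) :
    indVec (insert x τ) = indVec τ + Finsupp.single x 1 := by
  ext y
  simp only [Finsupp.add_apply, indVec_apply, single_one_apply, Finset.mem_insert]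
  by_cases hy : y = x
  · subst hy; simp [hx]
  · simp [hy, Ne.symm hy]

lemma degree_indVec (τ : Finset V) : (indVec τ).degree = τ.card := by
  induction τ using Finset.induction_on with
  | empty =>
    have : indVec (∅ : Finset V) = 0 := by ext x; simp [indVec_apply]
    simp [this]
  | insert x τ hx ih =>
    rw [indVec_insert hx, map_add, degree_single_one, ih, Finset.card_insert_of_notMem hx]

/-- In a fixed multidegree, multiplication by a variable only relabels monomials, so the Koszul
differential becomes the simplicial boundary. -/
lemma multidegreePart_koszulX (a : V →₀ ℕ) (b : ι) (c : Finset V → ι → MvPolynomial V K) :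
    multidegreePart a b (koszulX K c) = simplicialD (multidegreePart a b c) := by
  classical
  funext τ
  rw [koszulD_apply]
  unfold multidegreePart
  by_cases h : indVec τ ≤ a
  · rw [if_pos h, koszulD_apply, Finset.sum_apply, coeff_sum]
    refine Finset.sum_congr rfl fun x hx => ?_
    have hxτ : x ∉ τ := by simpa using hx
    rw [Pi.smul_apply, Pi.smul_apply, smul_eq_mul, one_smul, ← Int.cast_smul_eq_zsmul K,
      coeff_smul, Int.cast_smul_eq_zsmul, coeff_X_mul', indVec_insert hxτ, tsub_tsub]
    have hiff : x ∈ (a - indVec τ).support ↔ indVec τ + Finsupp.single x 1 ≤ a := by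
      have hax : (a - indVec τ) x = a x := by simp [indVec_apply, hxτ]
      rw [Finsupp.mem_support_iff, hax]
      constructor
      · intro h0 y
        rw [Finsupp.add_apply, single_one_apply]
        by_cases hy : x = y
        · subst hy; simp [indVec_apply, hxτ]; omega
        · simpa [hy] using h y
      · intro h0 h1
        have := h0 x
        simp [h1] at this
    simp only [hiff]
  · rw [if_neg h, Finset.sum_eq_zero]
    intro x hx
    rw [if_neg, smul_zero, smul_zero]
    rw [indVec_insert (by simpa using hx)]
    exact fun h' => h (le_trans le_self_add h')

lemma eq_of_multidegreePart_eq (h : ∀ a b, multidegreePart a b c = multidegreePart a b c') :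
    c = c' := by
  funext τ b
  ext m
  rw [← multidegreePart_add_indVec, ← multidegreePart_add_indVec, h]

lemma exists_of_multidegreeParts (μ : (V →₀ ℕ) → ι → Finset V → K) (A : Finset (V →₀ ℕ))
    (hA : ∀ a ∉ A, ∀ b, μ a b = 0) (hμ : ∀ a b τ, μ a b τ ≠ 0 → indVec τ ≤ a) :
    ∃ c : Finset V → ι → MvPolynomial V K, (∀ a b, multidegreePart a b c = μ a b) ∧
      ∀ τ b m, coeff m (c τ b) = μ (m + indVec τ) b τ := by
  classical
  have hc : ∀ τ b m, coeff m (∑ m ∈ A.image (fun a => a - indVec τ),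
      monomial m (μ (m + indVec τ) b τ)) = μ (m + indVec τ) b τ := by
    intro τ b m
    rw [coeff_sum]
    simp only [coeff_monomial]
    rw [Finset.sum_ite_eq']
    split_ifs with h
    · rfl
    · by_contra h0
      have h1 : m + indVec τ ∈ A := by
        by_contra h2
        rw [hA _ h2] at h0
        exact h0 rfl
      exact h (Finset.mem_image.2 ⟨_, h1, by simp⟩)
  refine ⟨fun τ b => ∑ m ∈ A.image (fun a => a - indVec τ), monomial m (μ (m + indVec τ) b τ),
    fun a b => ?_, hc⟩
  funext τ
  unfold multidegreePart
  split_ifs with h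
  · rw [hc, tsub_add_cancel_of_le h]
  · by_contra h0
    exact h (hμ a b τ (Ne.symm h0))

variable {U : Set (V →₀ ℕ)}

/-- The cycle is filled separately in each multidegree. Zero parts are filled by zero, which keeps
the result polynomial. Acyclicity is assumed only where `c` is nonzero, so that a free module can be
treated by avoiding `a = 0`. -/
lemma exists_koszulX_eq (hM : ∀ f, f ∈ M ↔ ∀ b, ∀ m ∈ (f b).support, m ∈ U)
    (hc : IsKoszulChain deg M p j c) (hd : koszulX K c = 0)
    (h : ∀ a b, multidegreePart a b c ≠ 0 → (a.degree : ℤ) + deg b = j →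
      AcyclicAt K (koszulComplex U a) p) :
    ∃ c', IsKoszulChain deg M (p + 1) j c' ∧ koszulX K c' = c := by
  classical
  have hne : ∀ a b τ, multidegreePart a b c τ ≠ 0 →
      τ ∈ koszulComplex U a ∧ τ.card = p ∧ (a.degree : ℤ) + deg b = j := by
    intro a b τ hτ
    unfold multidegreePart at hτ
    split_ifs at hτ with hle
    · have hcτ : c τ ≠ 0 := by
        intro h0; simp [h0] at hτ
      have hcard := hc.card τ hcτ
      refine ⟨mem_koszulComplex_iff.2 ⟨hle, (hM _).1 (hc.mem τ) b _ (mem_support_iff.2 hτ)⟩,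
        hcard, ?_⟩
      have h1 := hc.hom τ b _ (mem_support_iff.2 hτ)
      have h2 : a.degree = (a - indVec τ).degree + p := by
        rw [← hcard, ← degree_indVec τ, ← map_add, tsub_add_cancel_of_le hle]
      rw [h2]; push_cast; omega
    · exact absurd rfl hτ
  have hex : ∀ a b, ∃ μ : Finset V → K, IsSimplicialChain (koszulComplex U a) (p + 1) μ ∧
      simplicialD μ = multidegreePart a b c ∧ (multidegreePart a b c = 0 → μ = 0) := by
    intro a b
    by_cases h0 : multidegreePart a b c = 0
    · exact ⟨0, fun τ hτ => absurd rfl hτ, by rw [h0, map_zero], fun _ => rfl⟩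
    · obtain ⟨τ, hτ⟩ := Function.ne_iff.1 h0
      obtain ⟨μ, h1, h2⟩ := h a b h0 (hne a b τ hτ).2.2 (multidegreePart a b c)
        (fun σ hσ => ⟨(hne a b σ hσ).1, (hne a b σ hσ).2.1⟩) (by
          rw [← multidegreePart_koszulX, hd]
          funext σ; simp [multidegreePart])
      exact ⟨μ, h1, h2, fun h => absurd h h0⟩
  choose μ hμ1 hμ2 hμ3 using hex
  obtain ⟨c', hc', hcoeff⟩ := exists_of_multidegreeParts μ
    (Finset.univ.biUnion fun τ : Finset V => Finset.univ.biUnion fun b : ι =>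
      (c τ b).support.image fun m => m + indVec τ) (by
      intro a ha b
      refine hμ3 a b ?_
      by_contra h0
      obtain ⟨τ, hτ⟩ := Function.ne_iff.1 h0
      refine ha ?_
      simp only [multidegreePart, Pi.zero_apply] at hτ
      split_ifs at hτ with hle
      · simp only [Finset.mem_biUnion, Finset.mem_univ, true_and, Finset.mem_image]
        exact ⟨τ, b, _, mem_support_iff.2 hτ, tsub_add_cancel_of_le hle⟩
      · exact absurd rfl hτ)
    (fun a b τ hτ => (mem_koszulComplex_iff.1 (hμ1 a b τ hτ).1).1)
  have hne' : ∀ τ b m, coeff m (c' τ b) ≠ 0 → m ∈ U ∧ τ.card = p + 1 ∧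
      (m.degree : ℤ) + deg b = j - (p + 1 : ℕ) := by
    intro τ b m hm
    rw [hcoeff] at hm
    obtain ⟨h1, h2⟩ := hμ1 _ _ _ hm
    refine ⟨?_, h2, ?_⟩
    · simpa using (mem_koszulComplex_iff.1 h1).2
    · have h3 : multidegreePart (m + indVec τ) b c ≠ 0 := by
        intro h0
        rw [hμ3 _ _ h0] at hm
        exact hm rfl
      obtain ⟨σ, hσ⟩ := Function.ne_iff.1 h3
      have h4 := (hne _ _ _ hσ).2.2
      rw [map_add, degree_indVec, h2] at h4
      push_cast at h4 ⊢
      omega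
  refine ⟨c', ⟨fun τ => (hM _).2 fun b m hm => (hne' τ b m (mem_support_iff.1 hm)).1,
    fun τ hτ => ?_, fun τ b m hm => (hne' τ b m (mem_support_iff.1 hm)).2.2⟩, ?_⟩
  · obtain ⟨b, hb⟩ := Function.ne_iff.1 hτ
    obtain ⟨m, hm⟩ := MvPolynomial.ne_zero_iff.1 hb
    exact (hne' τ b m hm).2.1
  · refine eq_of_multidegreePart_eq fun a b => ?_
    rw [multidegreePart_koszulX, hc', hμ2]

lemma acyclicAt_of_koszulExactAt (hM : ∀ f, f ∈ M ↔ ∀ b, ∀ m ∈ (f b).support, m ∈ U)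
    (h : KoszulExactAt deg M p j) {a : V →₀ ℕ} {b : ι} (ha : (a.degree : ℤ) + deg b = j) :
    AcyclicAt K (koszulComplex U a) p := by
  classical
  intro l hl hd
  obtain ⟨c, hc, hcoeff⟩ := exists_of_multidegreeParts
    (fun a' b' => if a' = a ∧ b' = b then l else 0) {a} (by
      intro a' ha' b'
      rw [if_neg]
      exact fun h => ha' (by simp [h.1])) (by
      intro a' b' τ hτ
      split_ifs at hτ with h'
      · rw [h'.1]; exact (mem_koszulComplex_iff.1 (hl τ hτ).1).1
      · exact absurd rfl hτ)
  have hne : ∀ τ b' m, coeff m (c τ b') ≠ 0 → m + indVec τ = a ∧ b' = b ∧ m ∈ U ∧ τ.card = p := by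
    intro τ b' m hm
    rw [hcoeff] at hm
    split_ifs at hm with h'
    · obtain ⟨h1, h2⟩ := hl τ hm
      refine ⟨h'.1, h'.2, ?_, h2⟩
      rw [← h'.1] at h1
      simpa using (mem_koszulComplex_iff.1 h1).2
    · exact absurd rfl hm
  obtain ⟨c', hc', hcc'⟩ := h c ⟨fun τ => (hM _).2 fun b' m hm =>
      (hne τ b' m (mem_support_iff.1 hm)).2.2.1, fun τ hτ => by
        obtain ⟨b', hb'⟩ := Function.ne_iff.1 hτ
        obtain ⟨m, hm⟩ := MvPolynomial.ne_zero_iff.1 hb'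
        exact (hne τ b' m hm).2.2.2, fun τ b' m hm => by
        obtain ⟨h1, rfl, _, h3⟩ := hne τ b' m (mem_support_iff.1 hm)
        rw [← h1, map_add, degree_indVec, h3] at ha
        push_cast at ha
        omega⟩ (by
      refine eq_of_multidegreePart_eq fun a' b' => ?_
      rw [multidegreePart_koszulX, hc]
      split_ifs
      · rw [hd]; funext σ; simp [multidegreePart]
      · rw [map_zero]; funext σ; simp [multidegreePart])
  refine ⟨multidegreePart a b c', fun τ hτ => ?_, ?_⟩
  · unfold multidegreePart at hτ
    split_ifs at hτ with hle
    · refine ⟨mem_koszulComplex_iff.2 ⟨hle, (hM _).1 (hc'.mem τ) b _ (mem_support_iff.2 hτ)⟩,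
        hc'.card τ fun h0 => hτ ?_⟩
      rw [h0]; simp
    · exact absurd rfl hτ
  · rw [← multidegreePart_koszulX, hcc', hc]
    simp

lemma koszulExactAt_iff_acyclicAt (hM : ∀ f, f ∈ M ↔ ∀ b, ∀ m ∈ (f b).support, m ∈ U) :
    KoszulExactAt deg M p j ↔
      ∀ (a : V →₀ ℕ) (b : ι), (a.degree : ℤ) + deg b = j → AcyclicAt K (koszulComplex U a) p :=
  ⟨fun h _ _ ha => acyclicAt_of_koszulExactAt hM h ha,
    fun h _ hc hd => exists_koszulX_eq hM hc hd fun a b _ ha => h a b ha⟩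

/-- The Koszul homology of a free module is concentrated in homological degree zero, and there it
is spanned by the basis. -/
lemma exists_koszulX_eq_of_coeff_zero (hc : IsKoszulChain deg ⊤ p j c) (hd : koszulX K c = 0)
    (h0 : ∀ b, coeff 0 (c ∅ b) = 0) :
    ∃ c', IsKoszulChain deg ⊤ (p + 1) j c' ∧ koszulX K c' = c := by
  refine exists_koszulX_eq (U := Set.univ) (by simp) hc hd fun a b hab _ => ?_
  have ha : a ≠ 0 := by
    rintro rfl
    refine hab ?_
    funext τ
    unfold multidegreePart
    split_ifs with h
    · have : τ = ∅ := by
        ext x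
        have := h x
        by_contra hx
        simp only [Finset.notMem_empty, iff_false, not_not] at hx
        simp [indVec_apply, hx] at this
      subst this
      simpa using h0 b
    · rfl
  obtain ⟨z, hz⟩ := Finsupp.ne_iff.1 ha
  refine acyclicAt_of_cone z fun τ hτ => mem_koszulComplex_iff.2 ⟨fun y => ?_, trivial⟩
  have := (mem_koszulComplex_iff.1 hτ).1 y
  rw [indVec_apply] at this ⊢
  by_cases hy : y = z
  · subst hy; simp at hz ⊢; omega
  · simpa [hy] using this

end KoszulExact

/-! ## Dimension shifting -/

section Shift

variable {V : Type*} [LinearOrder V] [Fintype V] {K : Type*} [Field K]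
  {ι κ : Type*} [Fintype ι] [DecidableEq ι] [Fintype κ] {deg : ι → ℤ} {deg' : κ → ℤ}
  {φ : (ι → MvPolynomial V K) →ₗ[MvPolynomial V K] (κ → MvPolynomial V K)} {p : ℕ} {j : ℤ}

lemma koszulX_comp (c : Finset V → ι → MvPolynomial V K) (τ : Finset V) :
    koszulX K (fun σ => φ (c σ)) τ = φ (koszulX K c τ) := by
  rw [koszulD_apply, koszulD_apply, map_sum]
  refine Finset.sum_congr rfl fun x _ => ?_
  rw [map_zsmul, map_smul]

lemma IsKoszulChain.map {M : Submodule (MvPolynomial V K) (ι → MvPolynomial V K)}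
    (hφ : IsHomogeneousMap deg deg' φ) {c : Finset V → ι → MvPolynomial V K}
    (hc : IsKoszulChain deg M p j c) :
    IsKoszulChain deg' (LinearMap.range φ) p j fun τ => φ (c τ) where
  mem τ := LinearMap.mem_range_self φ _
  card τ h := hc.card τ fun h0 => h (by rw [h0, map_zero])
  hom τ := by
    have h1 := (hc.hom τ).homPart_eq
    rw [← h1, hφ.map_homPart]
    exact isHomogeneousVector_homPart _

lemma IsKoszulChain.exists_lift (hφ : IsHomogeneousMap deg deg' φ)
    {c : Finset V → κ → MvPolynomial V K} (hc : IsKoszulChain deg' (LinearMap.range φ) p j c) :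
    ∃ f : Finset V → ι → MvPolynomial V K, IsKoszulChain deg ⊤ p j f ∧ ∀ τ, φ (f τ) = c τ := by
  classical
  choose g hg using fun τ => LinearMap.mem_range.1 (hc.mem τ)
  refine ⟨fun τ => if c τ = 0 then 0 else homPart deg (j - p) (g τ), ⟨fun _ => trivial,
    fun τ h => hc.card τ fun h0 => h (by simp [h0]), fun τ => ?_⟩, fun τ => ?_⟩
  · split_ifs
    · exact isHomogeneousVector_zero
    · exact isHomogeneousVector_homPart _
  · dsimp only
    split_ifs with h
    · rw [h, map_zero]
    · rw [hφ.map_homPart, hg, (hc.hom τ).homPart_eq]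

lemma coeff_zero_koszulX (f : Finset V → ι → MvPolynomial V K) (τ : Finset V) (b : ι) :
    coeff 0 (koszulX K f τ b) = 0 := by
  rw [koszulD_apply, Finset.sum_apply, coeff_sum]
  refine Finset.sum_eq_zero fun x _ => ?_
  rw [Pi.smul_apply, Pi.smul_apply, smul_eq_mul, ← Int.cast_smul_eq_zsmul K, coeff_smul,
    coeff_X_mul', if_neg (by simp), smul_zero]

/-- The connecting map of `0 → ker φ → F → range φ → 0`. The free module has Koszul homology only in
degree zero, and `hmin` makes the homology of the kernel vanish there too, so the shift also holds
for `p = 0`. -/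
theorem koszulExactAt_range_succ_iff (hφ : IsHomogeneousMap deg deg' φ)
    (hmin : ∀ f ∈ LinearMap.ker φ, ∀ b, coeff 0 (f b) = 0) :
    KoszulExactAt deg' (LinearMap.range φ) (p + 1) j ↔ KoszulExactAt deg (LinearMap.ker φ) p j := by
  constructor
  · intro h c hc hd
    obtain ⟨f, hf, rfl⟩ := exists_koszulX_eq_of_coeff_zero (hc.of_mem fun _ => trivial) hd
      fun b => hmin _ (hc.mem ∅) b
    obtain ⟨m, hm, hm'⟩ := h _ (hf.map hφ) (by
      funext τ
      rw [koszulX_comp]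
      exact LinearMap.mem_ker.1 (hc.mem τ))
    obtain ⟨g, hg, hg'⟩ := hm.exists_lift hφ
    refine ⟨f - koszulX K g, (hf.sub hg.koszulX).of_mem fun τ => ?_, ?_⟩
    · rw [LinearMap.mem_ker, Pi.sub_apply, map_sub, ← koszulX_comp]
      simp only [hg']
      rw [hm', sub_self]
    · rw [map_sub, koszulD_koszulD, sub_zero]
  · intro h c hc hd
    obtain ⟨f, hf, hf'⟩ := hc.exists_lift hφ
    obtain ⟨n, hn, hn'⟩ := h (koszulX K f) (hf.koszulX.of_mem fun τ => by
      rw [LinearMap.mem_ker, ← koszulX_comp]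
      simp only [hf']
      exact congrFun hd τ) (koszulD_koszulD _ _)
    obtain ⟨g, hg, hg'⟩ := exists_koszulX_eq_of_coeff_zero
      (hf.sub (hn.of_mem (M' := ⊤) fun _ => trivial)) (by rw [map_sub, hn', sub_self]) (fun b => by
        have : (f - n) ∅ = 0 := by
          by_contra h0
          have := (hf.sub (hn.of_mem (M' := ⊤) fun _ => trivial)).card ∅ h0
          simp at this
        rw [this]; simp)
    refine ⟨fun τ => φ (g τ), hg.map hφ, ?_⟩
    funext τ
    rw [koszulX_comp, hg', Pi.sub_apply, map_sub, hf', LinearMap.mem_ker.1 (hn.mem τ), sub_zero]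

/-- Nakayama: if a basis vector had boundary image, subtracting a lifted boundary would give a
kernel element with constant coefficient 1, against `hmin`. -/
theorem koszulExactAt_range_zero_iff (hφ : IsHomogeneousMap deg deg' φ)
    (hmin : ∀ f ∈ LinearMap.ker φ, ∀ b, coeff 0 (f b) = 0) :
    KoszulExactAt deg' (LinearMap.range φ) 0 j ↔ ∀ b, deg b ≠ j := by
  constructor
  · intro h b hb
    have hc : IsKoszulChain deg' (LinearMap.range φ) 0 j
        (Pi.single (∅ : Finset V) (φ (Pi.single b 1))) := by
      refine ⟨fun τ => ?_, fun τ hτ => ?_, fun τ => ?_⟩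
      · by_cases hτ : τ = ∅
        · subst hτ; simp
        · rw [Pi.single_eq_of_ne hτ]; exact Submodule.zero_mem _
      · by_contra h0
        rw [Finset.card_eq_zero] at h0
        exact hτ (Pi.single_eq_of_ne h0 _)
      · by_cases hτ : τ = ∅
        · subst hτ
          rw [Pi.single_eq_same]
          simpa [hb] using hφ b
        · rw [Pi.single_eq_of_ne hτ]; exact isHomogeneousVector_zero
    obtain ⟨c', hc', he⟩ := h _ hc hc.koszulX_eq_zero
    obtain ⟨f, hf, hf'⟩ := hc'.exists_lift hφ
    have hk : Pi.single b 1 - koszulX K f ∅ ∈ LinearMap.ker φ := by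
      rw [LinearMap.mem_ker, map_sub, ← koszulX_comp]
      simp only [hf']
      rw [he, Pi.single_eq_same, sub_self]
    have := hmin _ hk b
    rw [Pi.sub_apply, Pi.single_eq_same, coeff_sub, coeff_zero_koszulX, coeff_zero_one] at this
    simp at this
  · intro h c hc _
    obtain ⟨f, hf, hf'⟩ := hc.exists_lift hφ
    obtain ⟨g, hg, hg'⟩ := exists_koszulX_eq_of_coeff_zero hf hf.koszulX_eq_zero fun b => by
      by_contra h0
      have := hf.hom ∅ b 0 (mem_support_iff.2 h0)
      refine h b ?_
      simpa using this
    refine ⟨fun τ => φ (g τ), hg.map hφ, ?_⟩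
    funext τ
    rw [koszulX_comp, hg', hf']

end Shift

/-! ## Betti numbers and Koszul homology -/

section Betti

variable {V : Type*} [LinearOrder V] [Fintype V] {K : Type*} [Field K]
  {I : Ideal (MvPolynomial V K)}

/-- The ideal `I` as a submodule of the free module of rank one. -/
def idealVec (I : Ideal (MvPolynomial V K)) :
    Submodule (MvPolynomial V K) (Fin 1 → MvPolynomial V K) :=
  Submodule.comap (LinearMap.proj 0) I

lemma mem_idealVec {f : Fin 1 → MvPolynomial V K} : f ∈ idealVec I ↔ f 0 ∈ I := Iff.rfl

namespace MinimalGradedFreeResolution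

variable (F : MinimalGradedFreeResolution I)

lemma constantCoeff_range_d (i : ℕ) (f) (hf : f ∈ LinearMap.range (F.d i)) (b) :
    coeff 0 (f b) = 0 := by
  obtain ⟨g, rfl⟩ := hf
  rw [← Finset.univ_sum_single g, map_sum, Finset.sum_apply, coeff_sum]
  refine Finset.sum_eq_zero fun c _ => ?_
  have : (Pi.single c (g c) : Fin (F.rank (i + 1)) → MvPolynomial V K) =
      g c • Pi.single c 1 := by
    rw [← Pi.single_smul, smul_eq_mul, mul_one]
  rw [this, map_smul, Pi.smul_apply, smul_eq_mul, ← constantCoeff_eq, map_mul, F.minimal, mul_zero]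

/-- Each dimension shift trades one homological degree for one step along the resolution, until
degree zero reads off generators. -/
lemma koszulExactAt_range_d_iff (q : ℕ) : ∀ (i k : ℕ) (_ : k = i + 1 + q) (j : ℤ),
    KoszulExactAt (F.deg i) (LinearMap.range (F.d i)) q j ↔ ∀ b, F.deg k b ≠ j := by
  induction q with
  | zero =>
    rintro i k rfl j
    refine koszulExactAt_range_zero_iff (F.d_homogeneous i) fun f hf => ?_
    rw [F.exact_succ] at hf
    exact F.constantCoeff_range_d _ f hf
  | succ q ih =>
    rintro i k rfl j
    rw [koszulExactAt_range_succ_iff (F.d_homogeneous i), F.exact_succ]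
    · exact ih (i + 1) _ (by ring) j
    · intro f hf
      rw [F.exact_succ] at hf
      exact F.constantCoeff_range_d _ f hf

lemma koszulExactAt_iff (i : ℕ) (j : ℤ) :
    KoszulExactAt (fun _ => 0) (idealVec I) i j ↔ ∀ b, F.deg i b ≠ j := by
  set φ : (Fin (F.rank 0) → MvPolynomial V K) →ₗ[MvPolynomial V K] (Fin 1 → MvPolynomial V K) :=
    LinearMap.pi fun _ => F.aug with hφ
  have hrange : LinearMap.range φ = idealVec I := by
    ext f
    rw [mem_idealVec, LinearMap.mem_range]
    have h1 : f 0 ∈ I ↔ f 0 ∈ LinearMap.range F.aug := by rw [F.range_aug]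
    rw [h1, LinearMap.mem_range]
    refine exists_congr fun g => ?_
    constructor
    · rintro rfl; rfl
    · intro h
      funext i
      rw [Subsingleton.elim i 0, ← h]; rfl
  have hker : LinearMap.ker φ = LinearMap.range (F.d 0) := by
    rw [← F.exact_zero]
    ext f
    rw [LinearMap.mem_ker, LinearMap.mem_ker]
    constructor
    · intro h; exact congrFun h 0
    · intro h; funext i; exact h
  have hhom : IsHomogeneousMap (F.deg 0) (fun _ => 0) φ := by
    intro b c m hm
    rw [add_zero]
    exact F.aug_homogeneous b m hm
  have hmin : ∀ f ∈ LinearMap.ker φ, ∀ b, coeff 0 (f b) = 0 := by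
    intro f hf
    rw [hker] at hf
    exact F.constantCoeff_range_d _ f hf
  rw [← hrange]
  cases i with
  | zero => exact koszulExactAt_range_zero_iff hhom hmin
  | succ i =>
    rw [koszulExactAt_range_succ_iff hhom hmin, hker]
    exact F.koszulExactAt_range_d_iff i 0 _ (by ring) j

end MinimalGradedFreeResolution

end Betti

/-! ## Existence of minimal graded free resolutions -/

section Existence

variable {V : Type*} [Finite V] {K : Type*} [Field K]

/-- `M` is a graded submodule of `⨁ b, S(-deg b)`. -/
def IsGradedSubmodule {ι : Type*} (deg : ι → ℤ)
    (M : Submodule (MvPolynomial V K) (ι → MvPolynomial V K)) : Prop :=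
  ∀ f ∈ M, ∀ j, homPart deg j f ∈ M

lemma IsHomogeneousMap.isGradedSubmodule_ker {ι κ : Type*} [Fintype ι] [DecidableEq ι]
    {deg : ι → ℤ} {deg' : κ → ℤ}
    {φ : (ι → MvPolynomial V K) →ₗ[MvPolynomial V K] (κ → MvPolynomial V K)}
    (hφ : IsHomogeneousMap deg deg' φ) : IsGradedSubmodule deg (LinearMap.ker φ) := by
  intro f hf j
  rw [LinearMap.mem_ker] at hf ⊢
  rw [hφ.map_homPart, hf, homPart_zero]

/-- `M` is generated by `n` homogeneous elements. -/
def HasHomogeneousGenerators {ι : Type*} (deg : ι → ℤ)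
    (M : Submodule (MvPolynomial V K) (ι → MvPolynomial V K)) (n : ℕ) : Prop :=
  ∃ (g : Fin n → ι → MvPolynomial V K) (e : Fin n → ℤ),
    (∀ b, IsHomogeneousVector deg (g b) (e b)) ∧ Submodule.span (MvPolynomial V K) (Set.range g) = M

lemma IsGradedSubmodule.exists_hasHomogeneousGenerators {ι : Type*} [Fintype ι] {deg : ι → ℤ}
    {M : Submodule (MvPolynomial V K) (ι → MvPolynomial V K)} (hM : IsGradedSubmodule deg M) :
    ∃ n, HasHomogeneousGenerators deg M n := by
  classical
  obtain ⟨n, g, hg⟩ := Submodule.fg_iff_exists_fin_generating_family.1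
    (IsNoetherian.noetherian M)
  set J : Finset ℤ := Finset.univ.biUnion fun i : Fin n => Finset.univ.biUnion fun b : ι =>
    (g i b).support.image fun m => (m.degree : ℤ) + deg b with hJ
  have hsum : ∀ i, g i = ∑ j ∈ J, homPart deg j (g i) := by
    intro i
    ext b m
    rw [Finset.sum_apply, coeff_sum]
    simp only [coeff_homPart]
    rw [Finset.sum_ite_eq]
    split_ifs with h
    · rfl
    · by_contra h0
      refine h ?_
      simp only [hJ, Finset.mem_biUnion, Finset.mem_univ, true_and, Finset.mem_image]
      exact ⟨i, b, m, mem_support_iff.2 h0, rfl⟩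
  have hgM : ∀ i, g i ∈ M := fun i => hg ▸ Submodule.subset_span (Set.mem_range_self i)
  set e := Fintype.equivFin (Fin n × J)
  refine ⟨_, fun k => homPart deg (e.symm k).2 (g (e.symm k).1), fun k => (e.symm k).2,
    fun b => isHomogeneousVector_homPart _, le_antisymm ?_ ?_⟩
  · rw [Submodule.span_le]
    rintro _ ⟨k, rfl⟩
    exact hM _ (hgM _) _
  · rw [← hg, Submodule.span_le]
    rintro _ ⟨i, rfl⟩
    rw [SetLike.mem_coe, hsum i]
    refine Submodule.sum_mem _ fun j hj => Submodule.subset_span ⟨e (i, ⟨j, hj⟩), ?_⟩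
    simp

lemma IsGradedSubmodule.exists_minimal_cover {ι : Type*} [Fintype ι] {deg : ι → ℤ}
    {M : Submodule (MvPolynomial V K) (ι → MvPolynomial V K)} (hM : IsGradedSubmodule deg M) :
    ∃ (n : ℕ) (e : Fin n → ℤ)
      (φ : (Fin n → MvPolynomial V K) →ₗ[MvPolynomial V K] (ι → MvPolynomial V K)),
      IsHomogeneousMap e deg φ ∧ LinearMap.range φ = M ∧
        ∀ f ∈ LinearMap.ker φ, ∀ b, coeff 0 (f b) = 0 := by
  classical
  have hex := hM.exists_hasHomogeneousGenerators
  obtain ⟨g, e, hge, hgM⟩ := Nat.find_spec hex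
  have hmin := fun n => @Nat.find_min _ _ hex n
  generalize Nat.find hex = n at g e hge hgM hmin
  set φ := Fintype.linearCombination (MvPolynomial V K) g with hφ
  have hφb : ∀ b, φ (Pi.single b 1) = g b := by
    intro b
    rw [hφ, Fintype.linearCombination_apply_single, one_smul]
  have hhom : IsHomogeneousMap e deg φ := by
    intro b
    rw [hφb]
    exact hge b
  refine ⟨n, e, φ, hhom, by rw [hφ, Fintype.range_linearCombination, hgM], ?_⟩
  intro f hf b
  by_contra hne
  cases n with
  | zero => exact b.elim0
  | succ n =>
    refine hmin n (Nat.lt_succ_self n) ⟨g ∘ b.succAbove, e ∘ b.succAbove, fun i => hge _, ?_⟩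
    -- In degree `e b` the coordinate at `b` of the relation is a nonzero constant, so `g b` is a
    -- combination of the other generators, against the minimality of their number.
    set h := homPart e (e b) f with hh
    have hker : φ h = 0 := LinearMap.mem_ker.1 (hhom.isGradedSubmodule_ker f hf (e b))
    have hC : h b = C (coeff 0 (f b)) := by
      ext m
      rw [hh, coeff_homPart, coeff_C]
      by_cases hm : 0 = m
      · subst hm; simp
      · rw [if_neg hm, if_neg]
        intro h1
        have : m.degree = 0 := by omega
        exact hm ((Finsupp.degree_eq_zero_iff _).1 this).symm
    refine le_antisymm ?_ ?_
    · rw [← hgM]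
      exact Submodule.span_mono (Set.range_comp_subset_range _ _)
    · rw [← hgM, Submodule.span_le]
      rintro _ ⟨i, rfl⟩
      rw [SetLike.mem_coe]
      have hother : ∀ i, i ≠ b → g i ∈ Submodule.span (MvPolynomial V K)
          (Set.range (g ∘ b.succAbove)) := by
        intro i hi
        obtain ⟨k, rfl⟩ := Fin.exists_succAbove_eq hi
        exact Submodule.subset_span ⟨k, rfl⟩
      by_cases hi : i = b
      · subst hi
        rw [hφ, Fintype.linearCombination_apply, ← Finset.add_sum_erase _ _ (Finset.mem_univ i),
          hC] at hker
        have h1 : (C (coeff 0 (f i)) : MvPolynomial V K) • g i ∈ Submodule.span (MvPolynomial V K)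
            (Set.range (g ∘ i.succAbove)) := by
          rw [eq_neg_of_add_eq_zero_left hker]
          refine Submodule.neg_mem _ (Submodule.sum_mem _ fun k hk => Submodule.smul_mem _ _ ?_)
          exact hother k (Finset.ne_of_mem_erase hk)
        have h2 := Submodule.smul_mem _ (C (coeff 0 (f i))⁻¹ : MvPolynomial V K) h1
        rwa [smul_smul, ← C_mul, inv_mul_cancel₀ hne, C_1, one_smul] at h2
      · exact hother i hi

variable (V K) in
/-- A graded submodule of a graded free module of finite rank. -/
structure GradedSubmoduleData where
  /-- the rank of the free module -/
  rank : ℕ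
  /-- the degrees of its basis -/
  deg : Fin rank → ℤ
  /-- the submodule -/
  carrier : Submodule (MvPolynomial V K) (Fin rank → MvPolynomial V K)
  /-- the submodule is graded -/
  graded : IsGradedSubmodule deg carrier

namespace GradedSubmoduleData

variable (P : GradedSubmoduleData V K)

/-- The rank of a minimal free cover. -/
def coverRank : ℕ := P.graded.exists_minimal_cover.choose

/-- The degrees of a minimal free cover. -/
def coverDeg : Fin P.coverRank → ℤ := P.graded.exists_minimal_cover.choose_spec.choose

/-- A minimal free cover. -/
def cover : (Fin P.coverRank → MvPolynomial V K) →ₗ[MvPolynomial V K]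
    (Fin P.rank → MvPolynomial V K) :=
  P.graded.exists_minimal_cover.choose_spec.choose_spec.choose

lemma cover_spec : IsHomogeneousMap P.coverDeg P.deg P.cover ∧ LinearMap.range P.cover = P.carrier ∧
    ∀ f ∈ LinearMap.ker P.cover, ∀ b, coeff 0 (f b) = 0 :=
  P.graded.exists_minimal_cover.choose_spec.choose_spec.choose_spec

/-- The first syzygy module. -/
def syzygy : GradedSubmoduleData V K where
  rank := P.coverRank
  deg := P.coverDeg
  carrier := LinearMap.ker P.cover
  graded := P.cover_spec.1.isGradedSubmodule_ker

/-- The iterated syzygy modules. -/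
def syzygies (P : GradedSubmoduleData V K) : ℕ → GradedSubmoduleData V K
  | 0 => P
  | n + 1 => (syzygies P n).syzygy

end GradedSubmoduleData

/-- Without existence, `gradedBetti` would take its default value 0. Minimal covers of successive
syzygy modules are spliced; no termination is required of the resolution. -/
theorem nonempty_minimalGradedFreeResolution {I : Ideal (MvPolynomial V K)}
    (hI : ∀ f ∈ I, ∀ m ∈ f.support, monomial m (coeff m f) ∈ I) :
    Nonempty (MinimalGradedFreeResolution I) := by
  have hgr : IsGradedSubmodule (fun _ : Fin 1 => (0 : ℤ))
      (Submodule.comap (LinearMap.proj 0) I :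
        Submodule (MvPolynomial V K) (Fin 1 → MvPolynomial V K)) := by
    intro f hf j
    exact I.sum_mem fun m hm => hI _ hf m (Finset.mem_filter.1 hm).1
  let P : GradedSubmoduleData V K := ⟨1, fun _ => 0, _, hgr⟩
  have hrange : ∀ i, LinearMap.range (P.syzygies (i + 1)).cover =
      LinearMap.ker (P.syzygies i).cover := fun i => (P.syzygies (i + 1)).cover_spec.2.1
  have hkerproj : ∀ f : Fin 1 → MvPolynomial V K, f 0 = 0 → f = 0 := by
    intro f h
    funext i
    rw [Subsingleton.elim i 0, h]; rfl
  have haug : LinearMap.range ((LinearMap.proj (0 : Fin 1)).comp P.cover) = I := by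
    ext f
    rw [LinearMap.mem_range]
    constructor
    · rintro ⟨g, rfl⟩
      have : P.cover g ∈ P.carrier := by
        rw [← P.cover_spec.2.1]; exact LinearMap.mem_range_self _ _
      exact this
    · intro hf
      have : (fun _ => f : Fin 1 → MvPolynomial V K) ∈ P.carrier := hf
      rw [← P.cover_spec.2.1] at this
      obtain ⟨g, hg⟩ := this
      exact ⟨g, congrFun hg 0⟩
  have hker : LinearMap.ker ((LinearMap.proj (0 : Fin 1)).comp P.cover) =
      LinearMap.ker P.cover := by
    ext f
    rw [LinearMap.mem_ker, LinearMap.mem_ker]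
    exact ⟨fun h => hkerproj _ h, fun h => congrFun h (0 : Fin 1)⟩
  exact ⟨{
    rank := fun i => (P.syzygies (i + 1)).rank
    deg := fun i => (P.syzygies (i + 1)).deg
    aug := (LinearMap.proj (0 : Fin 1)).comp P.cover
    d := fun i => (P.syzygies (i + 1)).cover
    aug_homogeneous := fun b m hm => by
      have := P.cover_spec.1 b 0 m hm
      exact (add_zero _).symm.trans this
    d_homogeneous := fun i b => (P.syzygies (i + 1)).cover_spec.1 b
    range_aug := haug
    exact_zero := hker.trans (hrange 0).symm
    exact_succ := fun i => (hrange (i + 1)).symm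
    minimal := fun i b c => by
      have h1 : (P.syzygies (i + 1)).cover (Pi.single b 1) ∈
          LinearMap.ker (P.syzygies i).cover := by
        rw [← hrange]; exact LinearMap.mem_range_self _ _
      exact (P.syzygies i).cover_spec.2.2 _ h1 c }⟩

end Existence

/-! ### Regularity of monomial ideals from upper Koszul complexes. -/

section Regularity

variable {V : Type*} [LinearOrder V] [Fintype V] {K : Type*} [Field K]
  {I : Ideal (MvPolynomial V K)} {U : Set (V →₀ ℕ)}

/-- The nonvanishing of the graded Betti numbers of a monomial ideal in terms of its upper Koszul
complexes. -/
theorem gradedBetti_ne_zero_iff (hI : ∀ f, f ∈ I ↔ ∀ m ∈ f.support, m ∈ U)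
    (i : ℕ) (j : ℤ) : gradedBetti I i j ≠ 0 ↔
      ∃ a : V →₀ ℕ, (a.degree : ℤ) = j ∧ ¬ AcyclicAt K (koszulComplex U a) i := by
  classical
  have hne : Nonempty (MinimalGradedFreeResolution I) := by
    refine nonempty_minimalGradedFreeResolution fun f hf m hm => (hI _).2 fun n hn => ?_
    have := support_monomial_subset hn
    rw [Finset.mem_singleton] at this
    rw [this]
    exact (hI f).1 hf m hm
  have hM : ∀ f : Fin 1 → MvPolynomial V K, f ∈ idealVec I ↔ ∀ b, ∀ m ∈ (f b).support, m ∈ U := by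
    intro f
    rw [mem_idealVec, hI]
    constructor
    · intro h b
      rw [Subsingleton.elim b 0]; exact h
    · intro h; exact h 0
  have h1 := hne.some.koszulExactAt_iff i j
  rw [koszulExactAt_iff_acyclicAt hM] at h1
  have h2 : gradedBetti I i j ≠ 0 ↔ ∃ b, hne.some.deg i b = j := by
    unfold gradedBetti
    rw [dif_pos hne, Nat.card_ne_zero]
    constructor
    · rintro ⟨⟨b, hb⟩, _⟩
      exact ⟨b, hb⟩
    · rintro ⟨b, hb⟩
      exact ⟨⟨b, hb⟩, inferInstance⟩
  rw [h2]
  constructor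
  · rintro ⟨b, hb⟩
    by_contra! hcon
    exact h1.1 (fun a _ ha => hcon a (by simpa using ha)) b hb
  · rintro ⟨a, ha, hac⟩
    by_contra! hcon
    exact hac (h1.2 hcon a 0 (by simpa using ha))

lemma regLE_of_forall_le (hI : ∀ f, f ∈ I ↔ ∀ m ∈ f.support, m ∈ U) {r : ℤ}
    (h : ∀ (i : ℕ) (j : ℤ), gradedBetti I i j ≠ 0 → j - i ≤ r) : RegLE K U r := by
  intro a _ p hp
  by_contra hac
  have := h p _ ((gradedBetti_ne_zero_iff hI p _).2 ⟨a, rfl, hac⟩)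
  omega

lemma le_regularity {i : ℕ} {j : ℤ} (h : gradedBetti I i j ≠ 0) :
    (((j - i : ℤ) : WithTop ℤ) : WithBot (WithTop ℤ)) ≤ regularity I :=
  le_sSup ⟨i, j, h, rfl⟩

end Regularity

/-! ## The monomials of the powers and symbolic powers of an edge ideal -/

section Ideals

variable {V : Type*} {K : Type*} [Field K] {G : SimpleGraph V}

lemma prodVec_cons {s : ℕ} (x : V) (u : Fin s → V) :
    prodVec (Fin.cons x u : Fin (s + 1) → V) = Finsupp.single x 1 + prodVec u := by
  simp [prodVec, Fin.sum_univ_succ]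

lemma isEdgeProduct_zero_iff {m : V →₀ ℕ} : IsEdgeProduct G 0 m ↔ m = 0 := by
  constructor
  · rintro ⟨u, v, _, rfl⟩
    simp [prodVec]
  · rintro rfl
    exact ⟨Fin.elim0, Fin.elim0, fun l => l.elim0, by simp [prodVec]⟩

lemma isEdgeProduct_succ_iff {s : ℕ} {m : V →₀ ℕ} : IsEdgeProduct G (s + 1) m ↔
    ∃ x y m', G.Adj x y ∧ IsEdgeProduct G s m' ∧
      m = Finsupp.single x 1 + Finsupp.single y 1 + m' := by
  constructor
  · rintro ⟨u, v, huv, rfl⟩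
    refine ⟨u 0, v 0, _, huv 0, ⟨Fin.tail u, Fin.tail v, fun l => huv l.succ, rfl⟩, ?_⟩
    rw [← Fin.cons_self_tail u, ← Fin.cons_self_tail v, prodVec_cons, prodVec_cons]
    simp only [Fin.cons_zero, Fin.tail_cons]
    abel
  · rintro ⟨x, y, _, hxy, ⟨u, v, huv, rfl⟩, rfl⟩
    refine ⟨Fin.cons x u, Fin.cons y v, fun l => ?_, ?_⟩
    · refine Fin.cases ?_ (fun i => ?_) l
      · simpa using hxy
      · simpa using huv i
    · rw [prodVec_cons, prodVec_cons]; abel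

lemma edgeIdeal_eq_span_monomials : edgeIdeal K G =
    Ideal.span ((fun m => monomial m (1 : K)) ''
      {m | ∃ x y, G.Adj x y ∧ m = Finsupp.single x 1 + Finsupp.single y 1}) := by
  unfold edgeIdeal
  congr 1
  ext f
  simp only [Set.mem_ofPred_eq, Set.mem_image]
  constructor
  · rintro ⟨u, v, huv, rfl⟩
    exact ⟨_, ⟨u, v, huv, rfl⟩, by rw [X, X, monomial_mul, mul_one]⟩
  · rintro ⟨_, ⟨u, v, huv, rfl⟩, rfl⟩
    exact ⟨u, v, huv, by rw [X, X, monomial_mul, mul_one]⟩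

lemma mem_edgeIdeal_iff (f : MvPolynomial V K) :
    f ∈ edgeIdeal K G ↔ ∀ m ∈ f.support, m ∈ edgeMonomials G.Adj := by
  classical
  rw [edgeIdeal_eq_span_monomials, mem_ideal_span_monomial_image]
  refine forall_congr' fun m => forall_congr' fun _ => ?_
  constructor
  · rintro ⟨_, ⟨x, y, hxy, rfl⟩, hle⟩
    refine ⟨x, y, hxy, fun h => ?_, fun h => ?_⟩
    · have := hle x
      simp [h] at this
    · have := hle y
      simp [h] at this
  · rintro ⟨x, y, hxy, hx, hy⟩
    refine ⟨_, ⟨x, y, hxy, rfl⟩, fun z => ?_⟩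
    rw [Finsupp.add_apply, Finsupp.single_apply, Finsupp.single_apply]
    by_cases h1 : x = z
    · subst h1
      rw [if_pos rfl, if_neg hxy.ne']
      omega
    · by_cases h2 : y = z
      · subst h2
        rw [if_neg h1, if_pos rfl]
        omega
      · simp [h1, h2]

lemma edgeIdeal_pow_eq_span_monomials (s : ℕ) : edgeIdeal K G ^ s =
    Ideal.span ((fun m => monomial m (1 : K)) '' {m | IsEdgeProduct G s m}) := by
  induction s with
  | zero =>
    have : {m : V →₀ ℕ | IsEdgeProduct G 0 m} = {0} := by
      ext m; simp [isEdgeProduct_zero_iff]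
    rw [this, pow_zero, Set.image_singleton, Ideal.one_eq_top, eq_comm, Ideal.eq_top_iff_one]
    exact Ideal.subset_span rfl
  | succ s ih =>
    rw [pow_succ', ih, edgeIdeal_eq_span_monomials, Ideal.span_mul_span']
    congr 1
    ext f
    simp only [Set.mem_mul, Set.mem_image, Set.mem_ofPred_eq, isEdgeProduct_succ_iff]
    constructor
    · rintro ⟨_, ⟨_, ⟨x, y, hxy, rfl⟩, rfl⟩, _, ⟨m', hm', rfl⟩, rfl⟩
      exact ⟨_, ⟨x, y, m', hxy, hm', rfl⟩, by rw [monomial_mul, mul_one]⟩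
    · rintro ⟨_, ⟨x, y, m', hxy, hm', rfl⟩, rfl⟩
      exact ⟨_, ⟨_, ⟨x, y, hxy, rfl⟩, rfl⟩, _, ⟨m', hm', rfl⟩, by rw [monomial_mul, mul_one]⟩

lemma mem_edgeIdeal_pow_iff (s : ℕ) (f : MvPolynomial V K) :
    f ∈ edgeIdeal K G ^ s ↔ ∀ m ∈ f.support, m ∈ powerMonomials G s := by
  rw [edgeIdeal_pow_eq_span_monomials, mem_ideal_span_monomial_image]
  rfl

lemma powerMonomials_subset_symbolicMonomials (t : ℕ) :
    powerMonomials G t ⊆ symbolicMonomials G t := by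
  rintro a ⟨_, ⟨u, v, huv, rfl⟩, hle⟩ C hC
  exact (le_sum_edgeProduct hC huv).trans (Finset.sum_le_sum fun x _ => hle x)

lemma mem_symbolicPower_iff {R : Type*} [CommRing R] (I : Ideal R) (t : ℕ) (f : R) :
    f ∈ I.symbolicPower t ↔ ∀ p ∈ I.minimalPrimes, ∃ c, c ∉ p ∧ c * f ∈ I ^ t := by
  unfold Ideal.symbolicPower
  rw [Submodule.mem_iInf, Subtype.forall]
  refine forall_congr' fun p => forall_congr' fun hp => ?_
  have : p.IsPrime := Ideal.IsMinimalPrime.isPrime hp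
  rw [LinearMap.mem_ker, LinearMap.comp_apply,
    IsLocalizedModule.eq_zero_iff p.primeCompl]
  constructor
  · rintro ⟨c, hc⟩
    refine ⟨c, c.2, ?_⟩
    rw [← smul_eq_mul, ← Submodule.Quotient.mk_eq_zero (I ^ t)]
    exact hc
  · rintro ⟨c, hc, h⟩
    refine ⟨⟨c, hc⟩, ?_⟩
    rw [← smul_eq_mul, ← Submodule.Quotient.mk_eq_zero (I ^ t)] at h
    exact h

variable [Fintype V]

open Classical in
/-- The order of a polynomial along the linear subspace where the variables of `C` vanish. -/
def coverOrder (C : Finset V) (f : MvPolynomial V K) : ℕ∞ :=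
  MvPowerSeries.weightedOrder (fun x => if x ∈ C then 1 else 0) (f : MvPowerSeries V K)

/-- Additivity lets a multiplier of order zero be cancelled; it also yields primality of
`variableIdeal`. -/
lemma coverOrder_mul (C : Finset V) (f g : MvPolynomial V K) :
    coverOrder C (f * g) = coverOrder C f + coverOrder C g := by
  unfold coverOrder
  rw [coe_mul, MvPowerSeries.weightedOrder_mul]

lemma le_coverOrder_iff (C : Finset V) (f : MvPolynomial V K) (t : ℕ) :
    (t : ℕ∞) ≤ coverOrder C f ↔ ∀ m ∈ f.support, t ≤ ∑ x ∈ C, m x := by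
  classical
  have hw : ∀ m : V →₀ ℕ, Finsupp.weight (fun x => if x ∈ C then 1 else 0) m = ∑ x ∈ C, m x := by
    intro m
    rw [Finsupp.weight_apply, Finsupp.sum_fintype _ _ (by simp)]
    simp
  unfold coverOrder
  constructor
  · intro h m hm
    have h1 := h.trans (MvPowerSeries.weightedOrder_le (d := m) _
      (by rw [coeff_coe]; exact mem_support_iff.1 hm))
    rw [hw] at h1
    exact_mod_cast h1
  · intro h
    refine MvPowerSeries.nat_le_weightedOrder _ fun d hd => ?_
    rw [coeff_coe]
    by_contra h0
    have := h d (mem_support_iff.2 h0)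
    rw [hw] at hd
    omega

/-- The prime ideal generated by the variables in `C`. -/
abbrev variableIdeal (K : Type*) [Field K] (C : Finset V) : Ideal (MvPolynomial V K) :=
  Ideal.span (X '' (C : Set V))

lemma mem_variableIdeal_iff (C : Finset V) (f : MvPolynomial V K) :
    f ∈ variableIdeal K C ↔ 1 ≤ coverOrder C f := by
  rw [mem_ideal_span_X_image, ← Nat.cast_one, le_coverOrder_iff]
  refine forall_congr' fun m => forall_congr' fun _ => ?_
  rw [Nat.one_le_iff_ne_zero, Ne, Finset.sum_eq_zero_iff]
  push Not
  simp

lemma coverOrder_eq_zero_iff (C : Finset V) (f : MvPolynomial V K) :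
    coverOrder C f = 0 ↔ f ∉ variableIdeal K C := by
  rw [mem_variableIdeal_iff, Order.one_le_iff_ne_zero, not_not]

lemma isPrime_variableIdeal (C : Finset V) : (variableIdeal K C).IsPrime := by
  refine Ideal.isPrime_iff.2 ⟨?_, fun {f g} h => ?_⟩
  · rw [Ideal.ne_top_iff_one, ← coverOrder_eq_zero_iff]
    unfold coverOrder
    rw [coe_one, MvPowerSeries.weightedOrder_one]
  · by_contra! hcon
    rw [← coverOrder_eq_zero_iff, ← coverOrder_eq_zero_iff] at hcon
    rw [mem_variableIdeal_iff, coverOrder_mul, hcon.1, hcon.2] at h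
    simp at h

lemma X_mem_variableIdeal_iff (C : Finset V) (x : V) :
    (X x : MvPolynomial V K) ∈ variableIdeal K C ↔ x ∈ C := by
  classical
  rw [mem_ideal_span_X_image]
  simp [support_X, Finsupp.single_apply]

lemma edgeIdeal_le_variableIdeal {C : Finset V} (hC : G.IsVertexCover C) :
    edgeIdeal K G ≤ variableIdeal K C := by
  refine Ideal.span_le.2 ?_
  rintro _ ⟨u, v, huv, rfl⟩
  rcases hC huv with h | h
  · exact Ideal.mul_mem_right _ _ ((X_mem_variableIdeal_iff C u).2 (by simpa using h))
  · exact Ideal.mul_mem_left _ _ ((X_mem_variableIdeal_iff C v).2 (by simpa using h))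

open Classical in
/-- The variables contained in the ideal `p`. -/
def idealCover (p : Ideal (MvPolynomial V K)) : Finset V :=
  Finset.univ.filter fun x => (X x : MvPolynomial V K) ∈ p

lemma mem_idealCover {p : Ideal (MvPolynomial V K)} {x : V} : x ∈ idealCover p ↔ X x ∈ p := by
  simp [idealCover]

lemma isVertexCover_idealCover {p : Ideal (MvPolynomial V K)} [hp : p.IsPrime]
    (h : edgeIdeal K G ≤ p) : G.IsVertexCover (idealCover p) := by
  intro u v huv
  have : (X u * X v : MvPolynomial V K) ∈ p := h (Ideal.subset_span ⟨u, v, huv, rfl⟩)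
  rcases hp.mem_or_mem this with h | h
  · exact Or.inl (by simpa using mem_idealCover.2 h)
  · exact Or.inr (by simpa using mem_idealCover.2 h)

lemma variableIdeal_idealCover_le (p : Ideal (MvPolynomial V K)) :
    variableIdeal K (idealCover p) ≤ p := by
  refine Ideal.span_le.2 ?_
  rintro _ ⟨x, hx, rfl⟩
  exact mem_idealCover.1 (by simpa using hx)

/-- Otherwise `x` could be dropped from the cover, giving a prime over the edge ideal strictly
inside `p`. -/
lemma exists_neighbor_of_mem_idealCover {p : Ideal (MvPolynomial V K)}
    (hp : p ∈ (edgeIdeal K G).minimalPrimes) {x : V} (hx : x ∈ idealCover p) :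
    ∃ y, G.Adj x y ∧ y ∉ idealCover p := by
  classical
  have : p.IsPrime := Ideal.IsMinimalPrime.isPrime hp
  have hcov := isVertexCover_idealCover hp.1.2
  have hnot : ¬ G.IsVertexCover (((idealCover p).erase x : Finset V) : Set V) := by
    intro h
    have h1 := hp.2 ⟨isPrime_variableIdeal _, edgeIdeal_le_variableIdeal h⟩
      ((Ideal.span_mono (Set.image_mono (by
        exact_mod_cast Finset.erase_subset x _))).trans (variableIdeal_idealCover_le p))
    have h2 := (X_mem_variableIdeal_iff _ _).1 (h1 (mem_idealCover.1 hx))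
    simp at h2
  unfold SimpleGraph.IsVertexCover at hnot
  push Not at hnot
  obtain ⟨u, v, huv, hu, hv⟩ := hnot
  simp only [Finset.coe_erase, Set.mem_sdiff, Finset.mem_coe, Set.mem_singleton_iff, not_and,
    not_not] at hu hv
  by_cases hux : u = x
  · subst hux
    exact ⟨v, huv, fun h => huv.ne (hv h).symm⟩
  · have hu' : u ∉ idealCover p := fun h => hux (hu h)
    have hv' := (hcov huv).resolve_left (by simpa using hu')
    have := hv (by simpa using hv')
    subst this
    exact ⟨u, huv.symm, hu'⟩

/-- Every cover contains one coming from a minimal prime `p`. A multiplier outside `p` has order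
zero along that cover, so membership of `c * f` in the `t`-th power forces the order of `f` to be at
least `t`. The converse is checked on monomials. -/
lemma mem_symbolicPower_edgeIdeal_iff (t : ℕ) (f : MvPolynomial V K) :
    f ∈ (edgeIdeal K G).symbolicPower t ↔ ∀ m ∈ f.support, m ∈ symbolicMonomials G t := by
  classical
  constructor
  · intro hf m hm C hC
    have := isPrime_variableIdeal (K := K) C
    obtain ⟨p, hp, hpC⟩ := Ideal.exists_minimalPrimes_le (edgeIdeal_le_variableIdeal (K := K) hC)
    have : p.IsPrime := Ideal.IsMinimalPrime.isPrime hp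
    obtain ⟨c, hc, hcf⟩ := (mem_symbolicPower_iff _ _ _).1 hf p hp
    have hcov := isVertexCover_idealCover hp.1.2
    have hsub : idealCover p ⊆ C := fun x hx =>
      (X_mem_variableIdeal_iff C x).1 (hpC (mem_idealCover.1 hx))
    have hc0 : coverOrder (idealCover p) c = 0 :=
      (coverOrder_eq_zero_iff _ _).2 fun h => hc (variableIdeal_idealCover_le p h)
    have h1 : (t : ℕ∞) ≤ coverOrder (idealCover p) (c * f) :=
      (le_coverOrder_iff _ _ _).2 fun m hm => powerMonomials_subset_symbolicMonomials t
        ((mem_edgeIdeal_pow_iff t _).1 hcf m hm) _ hcov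
    rw [coverOrder_mul, hc0, zero_add] at h1
    exact ((le_coverOrder_iff _ _ _).1 h1 m hm).trans (Finset.sum_le_sum_of_subset hsub)
  · intro h
    rw [← support_sum_monomial_coeff f]
    refine Ideal.sum_mem _ fun m hm => (mem_symbolicPower_iff _ _ _).2 fun p hp => ?_
    have hpp : p.IsPrime := Ideal.IsMinimalPrime.isPrime hp
    have hcov := isVertexCover_idealCover hp.1.2
    have ht := h m hm _ hcov
    have hex : ∀ x, ∃ y, x ∈ idealCover p → G.Adj x y ∧ y ∉ idealCover p := by
      intro x
      by_cases hx : x ∈ idealCover p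
      · obtain ⟨y, hy⟩ := exists_neighbor_of_mem_idealCover hp hx
        exact ⟨y, fun _ => hy⟩
      · exact ⟨x, fun h => absurd h hx⟩
    choose n hn using hex
    -- Each covered vertex is paired with a neighbour outside the cover: the multiplier avoids `p`
    -- and completes the covered part of the monomial to a product of at least `t` edges.
    refine ⟨∏ x ∈ idealCover p, X (n x) ^ m x, fun hmem => ?_, ?_⟩
    · obtain ⟨x, hx, hmem⟩ := hpp.prod_mem_iff.1 hmem
      exact (hn x hx).2 (mem_idealCover.2 (hpp.mem_of_pow_mem _ hmem))
    · have hmon : monomial m (coeff m f) = (∏ x ∈ idealCover p, X x ^ m x) *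
          (C (coeff m f) * ∏ x ∈ (idealCover p)ᶜ, X x ^ m x) := by
        rw [monomial_eq, Finsupp.prod_fintype _ _ (by simp),
          ← Finset.prod_mul_prod_compl (idealCover p)]
        ring
      rw [hmon, ← mul_assoc, ← Finset.prod_mul_distrib]
      refine Ideal.mul_mem_right _ _ (Ideal.pow_le_pow_right ht ?_)
      rw [← Finset.prod_pow_eq_pow_sum]
      refine Ideal.prod_mem_prod fun x hx => ?_
      rw [← mul_pow]
      have hedge : (X (n x) * X x : MvPolynomial V K) ∈ edgeIdeal K G :=
        Ideal.subset_span ⟨n x, x, (hn x hx).1.symm, rfl⟩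
      exact Ideal.pow_mem_pow hedge _

end Ideals

end

/-! ### The regularity bound. -/

theorem theorem3p8 {K : Type*} [Field K] {V : Type*} [Finite V] (G : SimpleGraph V)
    (s : ℕ) (hs : 1 ≤ s)
    (hG : ∀ (v : V) (c : G.Walk v v), c.IsCycle → Odd c.length →
      ¬ ((c.length : ℤ) ≤ 2 * (s : ℤ) - 3)) :
    regularity ((edgeIdeal K G).symbolicPower (s + 1)) ≤
      max (regularity (edgeIdeal K G) + ((2 * s : ℕ) : WithBot (WithTop ℤ)))
        (regularity ((edgeIdeal K G) ^ s)) := by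
  classical
  let : Fintype V := Fintype.ofFinite V
  -- Any linear order serves: it fixes the Koszul signs and the lexicographic order.
  let : LinearOrder V := LinearOrder.lift' (Fintype.equivFin V) (Fintype.equivFin V).injective
  refine sSup_le ?_
  rintro _ ⟨i, j, hij, rfl⟩
  by_contra! hlt
  obtain ⟨hlt1, hlt2⟩ := max_lt_iff.1 hlt
  obtain ⟨a, ha, hac⟩ := (gradedBetti_ne_zero_iff (mem_symbolicPower_edgeIdeal_iff (s + 1)) i j).1 hij
  -- Failure of the bound at `(i, j)` puts both regularities on the right strictly below `j - i`
  -- (the first after adding `2s`). Integrality turns this into the bounds with `- 1`, and infinite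
  -- values need no separate case.
  have h1 : RegLE K (edgeMonomials G.Adj) (j - i - 1 - 2 * s) := by
    refine regLE_of_forall_le mem_edgeIdeal_iff fun i' j' h => ?_
    have h2 := (add_le_add_left (le_regularity h) ((2 * s : ℕ) : WithBot (WithTop ℤ))).trans_lt hlt1
    have h3 : ((((j' - i' + (2 * s : ℕ) : ℤ)) : WithTop ℤ) : WithBot (WithTop ℤ)) <
        (((j - i : ℤ) : WithTop ℤ) : WithBot (WithTop ℤ)) := h2
    have h4 : j' - i' + ((2 * s : ℕ) : ℤ) < j - i := by exact_mod_cast h3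
    push_cast at h4
    omega
  have h2 : RegLE K (powerMonomials G s) (j - i - 1) := by
    refine regLE_of_forall_le (mem_edgeIdeal_pow_iff s) fun i' j' h => ?_
    have h3 := (le_regularity h).trans_lt hlt2
    have h4 : j' - (i' : ℤ) < j - i := by exact_mod_cast h3
    omega
  have hsub : symbolicMonomials G (s + 1) ⊆ powerMonomials G s := by
    refine symbolicMonomials_subset_powerMonomials fun v c hc hodd => ?_
    have h3 := hG v c hc hodd
    -- Parity improves `2s - 2 ≤ c.length` to `2s - 1 ≤ c.length`.
    obtain ⟨k, hk⟩ := hodd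
    omega
  have h3 : RegLE K (symbolicMonomials G (s + 1)) (j - i - 1 - 2 * s + 2 * s) := by
    refine regLE_symbolicMonomials hs h1 ?_
    rw [Set.union_eq_right.2 hsub, sub_add_cancel]
    exact h2
  refine hac (h3 a (by simp) i ?_)
  rw [ha]
  omega
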